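/- Let $\Bbbk$ be a field and let $R$, $S$ be standard graded $\Bbbk$-algebras, i.e. graded quotients of polynomial rings over $\Bbbk$ in finitely many variables of degree $1$. Write $\operatorname{Mod}^*_R$ for the category of $\mathbb Z$-graded $R$-modules and degree-preserving homomorphisms. For a homogeneous ideal $I\subseteq R$ let $\Gamma_I:\operatorname{Mod}^*_R\to\operatorname{Mod}^*_R$, $\Gamma_I(M)=\{z\in M\mid I^nz=0\text{ for some }n\ge 0\}$, and let $H^j_I=\mathscr R^j\Gamma_I$ be its right derived functors on $\operatorname{Mod}^*_R$. The Segre product of $M\in\operatorname{Mod}^*_R$ and $N\in\operatorname{Mod}^*_S$ is $M\#N=\bigoplus_{n\in\mathbb Z}M_n\otimes_\Bbbk N_n$, a graded module over the graded ring $R\#S=\bigoplus_{n\ge 0}R_n\otimes_\Bbbk S_n$; for homogeneous ideals $I\subseteq R$, $J\subseteq S$, $I\#J=\bigoplus_{n\ge 0} I_n\otimes_\Bbbk J_n$ is a homogeneous ideal of $R\#S$. The Segre product $A^\bullet\#B^\bullet$ of complexes in $\operatorname{Mod}^*_R$ and $\operatorname{Mod}^*_S$ is the complex with terms $\bigoplus_{i+j=k}A^i\#B^j$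 and differential $d_A\#\mathrm{id}+(-1)^i(\mathrm{id}\#d_B)$ on $A^i\#B^j$. **Theorem.** Let $M\in\operatorname{Mod}^*_R$ and $N\in\operatorname{Mod}^*_S$, and let $0\to M\to E^\bullet$ and $0\to N\to F^\bullet$ be injective resolutions in $\operatorname{Mod}^*_R$ and $\operatorname{Mod}^*_S$. Then, for every homogeneous ideal $I$ of $R$ and every homogeneous ideal $J$ of $S$, the complex $C^\bullet=E^\bullet\#F^\bullet$ is a $\Gamma_{I\#J}$-acyclic resolution of $M\#N$ in $\operatorname{Mod}^*_{R\#S}$; that is, $H^0(C^\bullet)\cong M\#N$, $H^j(C^\bullet)=0$ for all $j\ne 0$, and $H^j_{I\#J}(C^i)=0$ for all $i\ge 0$ and $j\neq 0$. In particular, $$H^k\big(\Gamma_{I\#J}(E^\bullet\#F^\bullet)\big)\cong H^k_{I\#J}(M\#N)\quad\text{in }\operatorname{Mod}^*_{R\#S}\text{ for every }k\ge 0.$$ -/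

import Mathlib

open CategoryTheory CategoryTheory.Limits
open scoped TensorProduct DirectSum

universe u

/-- A standard graded `k`-algebra: a graded quotient of a polynomial ring in finitely many variables
with the standard grading. -/
def IsStandardGraded {k R : Type u} [Field k] [CommRing R] [Algebra k R]
    (𝒜 : ℕ → Submodule k R) : Prop :=
  ∃ (n : ℕ) (φ : MvPolynomial (Fin n) k →ₐ[k] R), Function.Surjective φ ∧
    ∀ (d : ℕ) (p : MvPolynomial (Fin n) k), p.IsHomogeneous d → φ p ∈ 𝒜 d

/-- A `ℤ`-graded module over the `ℕ`-graded `k`-algebra `R = ⨁ 𝒜 i`, given by its homogeneous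
components `X n` (so the module is `⨁ n, X n`) and the multiplication maps
`𝒜 i × X j → X (i + j)`. To avoid casts, the equation `i + j = l` is an argument. -/
structure GrMod {k R : Type u} [Field k] [CommRing R] [Algebra k R]
    (𝒜 : ℕ → Submodule k R) [GradedAlgebra 𝒜] where
  X : ℤ → Type u
  [grp : ∀ n, AddCommGroup (X n)]
  [mod : ∀ n, Module k (X n)]
  act : ∀ {i : ℕ} {j l : ℤ}, (i : ℤ) + j = l → (𝒜 i →ₗ[k] X j →ₗ[k] X l)
  one_act : ∀ {j : ℤ} (h : ((0 : ℕ) : ℤ) + j = j) (m : X j),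
    act h ⟨1, SetLike.GradedOne.one_mem⟩ m = m
  mul_act : ∀ {i i' : ℕ} {j l p : ℤ} (h : (i' : ℤ) + j = l) (h' : (i : ℤ) + l = p)
    (h'' : ((i + i' : ℕ) : ℤ) + j = p) (a : 𝒜 i) (b : 𝒜 i') (m : X j),
    act h'' ⟨(a : R) * (b : R), SetLike.GradedMul.mul_mem a.2 b.2⟩ m = act h' a (act h b m)

attribute [instance] GrMod.grp GrMod.mod

namespace GrMod

section Category

variable {k R : Type u} [Field k] [CommRing R] [Algebra k R]
  {𝒜 : ℕ → Submodule k R} [GradedAlgebra 𝒜]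

/-- Homomorphisms of graded modules preserving degrees. -/
@[ext]
structure Hom (M N : GrMod 𝒜) where
  app : ∀ n, M.X n →ₗ[k] N.X n
  comm : ∀ {i : ℕ} {j l : ℤ} (h : (i : ℤ) + j = l) (a : 𝒜 i) (m : M.X j),
    app l (M.act h a m) = N.act h a (app j m)

instance : Category (GrMod 𝒜) where
  Hom := Hom
  id M := ⟨fun _ => LinearMap.id, fun _ _ _ => rfl⟩
  comp f g := ⟨fun n => (g.app n).comp (f.app n), fun h a m => by simp [f.comm, g.comm]⟩

@[ext]
theorem hom_ext {M N : GrMod 𝒜} {f g : M ⟶ N} (h : ∀ n x, Hom.app f n x = Hom.app g n x) :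
    f = g :=
  Hom.ext (funext fun n => LinearMap.ext (h n))

@[simp] theorem id_app (M : GrMod 𝒜) (n : ℤ) (x : M.X n) : Hom.app (𝟙 M) n x = x := rfl

@[simp] theorem comp_app {M N P : GrMod 𝒜} (f : M ⟶ N) (g : N ⟶ P) (n : ℤ) (x : M.X n) :
    Hom.app (f ≫ g) n x = Hom.app g n (Hom.app f n x) := rfl

instance (M N : GrMod 𝒜) : Zero (M ⟶ N) := ⟨⟨fun _ => 0, fun _ _ _ => by simp⟩⟩
instance (M N : GrMod 𝒜) : Add (M ⟶ N) :=
  ⟨fun f g => ⟨fun n => Hom.app f n + Hom.app g n, fun _ _ _ => by simp [f.comm, g.comm]⟩⟩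
instance (M N : GrMod 𝒜) : Neg (M ⟶ N) :=
  ⟨fun f => ⟨fun n => -Hom.app f n, fun _ _ _ => by simp [f.comm]⟩⟩

@[simp] theorem zero_app (M N : GrMod 𝒜) (n : ℤ) (x : M.X n) :
    Hom.app (0 : M ⟶ N) n x = 0 := rfl
@[simp] theorem add_app {M N : GrMod 𝒜} (f g : M ⟶ N) (n : ℤ) (x : M.X n) :
    Hom.app (f + g) n x = Hom.app f n x + Hom.app g n x := rfl
@[simp] theorem neg_app {M N : GrMod 𝒜} (f : M ⟶ N) (n : ℤ) (x : M.X n) :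
    Hom.app (-f) n x = -Hom.app f n x := rfl

instance (M N : GrMod 𝒜) : AddCommGroup (M ⟶ N) where
  add_assoc _ _ _ := by ext; simp [add_assoc]
  zero_add _ := by ext; simp
  add_zero _ := by ext; simp
  add_comm _ _ := by ext; simp [add_comm]
  neg_add_cancel _ := by ext; simp
  nsmul := nsmulRec
  zsmul := zsmulRec

instance : Preadditive (GrMod 𝒜) where
  add_comp _ _ _ _ _ _ := by ext; simp
  comp_add _ _ _ _ _ _ := by ext; simp

/-- A graded submodule, given by its homogeneous components. -/
structure Sub (M : GrMod 𝒜) where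
  carrier : ∀ n, Submodule k (M.X n)
  act_mem : ∀ {i : ℕ} {j l : ℤ} (h : (i : ℤ) + j = l) (a : 𝒜 i) {m : M.X j},
    m ∈ carrier j → M.act h a m ∈ carrier l

namespace Sub

variable {M : GrMod 𝒜}

/-- A graded submodule as a graded module. -/
@[simps X] def obj (S : Sub M) : GrMod 𝒜 where
  X n := S.carrier n
  act h := LinearMap.mk₂ k (fun a m => ⟨M.act h a m.1, S.act_mem h a m.2⟩)
    (fun _ _ _ => Subtype.ext (by simp)) (fun _ _ _ => Subtype.ext (by simp))
    (fun _ _ _ => Subtype.ext (by simp)) (fun _ _ _ => Subtype.ext (by simp))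
  one_act h m := Subtype.ext (M.one_act h m.1)
  mul_act h h' h'' a b m := Subtype.ext (M.mul_act h h' h'' a b m.1)

/-- The inclusion of a graded submodule. -/
def ι (S : Sub M) : S.obj ⟶ M := Hom.mk (fun n => (S.carrier n).subtype) (fun _ _ _ => rfl)

@[simp] theorem ι_app (S : Sub M) (n : ℤ) (x : S.carrier n) : Hom.app S.ι n x = x.1 := rfl

/-- Factor a morphism through a graded submodule containing its image. -/
def lift (S : Sub M) {N : GrMod 𝒜} (f : N ⟶ M) (hf : ∀ n x, Hom.app f n x ∈ S.carrier n) :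
    N ⟶ S.obj :=
  Hom.mk (fun n => (Hom.app f n).codRestrict _ (hf n)) (fun h a m => Subtype.ext (f.comm h a m))

@[simp] theorem lift_app (S : Sub M) {N : GrMod 𝒜} (f : N ⟶ M) (hf) (n : ℤ) (x : N.X n) :
    (Hom.app (S.lift f hf) n x : S.carrier n) = ⟨Hom.app f n x, hf n x⟩ := rfl

/-- The quotient by a graded submodule. -/
@[simps X] def quo (S : Sub M) : GrMod 𝒜 where
  X n := M.X n ⧸ S.carrier n
  act {i j l} h := LinearMap.mk₂ k
    (fun a m => (S.carrier j).mapQ (S.carrier l) (M.act h a) (fun _ hm => S.act_mem h a hm) m)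
    (fun a a' m => by obtain ⟨m, rfl⟩ := Submodule.mkQ_surjective _ m; simp)
    (fun c a m => by obtain ⟨m, rfl⟩ := Submodule.mkQ_surjective _ m; simp)
    (fun _ _ _ => by simp) (fun _ _ _ => by simp)
  one_act h m := by
    obtain ⟨m, rfl⟩ := Submodule.mkQ_surjective _ m
    exact congrArg _ (M.one_act h m)
  mul_act h h' h'' a b m := by
    obtain ⟨m, rfl⟩ := Submodule.mkQ_surjective _ m
    exact congrArg _ (M.mul_act h h' h'' a b m)

/-- The projection to the quotient by a graded submodule. -/
def π (S : Sub M) : M ⟶ S.quo := Hom.mk (fun n => (S.carrier n).mkQ) (fun _ _ _ => rfl)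

@[simp] theorem π_app (S : Sub M) (n : ℤ) (x : M.X n) :
    Hom.app S.π n x = (S.carrier n).mkQ x := rfl

/-- Factor a morphism killing a graded submodule through the quotient. -/
def desc (S : Sub M) {N : GrMod 𝒜} (f : M ⟶ N) (hf : ∀ n, ∀ x ∈ S.carrier n, Hom.app f n x = 0) :
    S.quo ⟶ N :=
  Hom.mk (fun n => (S.carrier n).liftQ (Hom.app f n) (hf n)) (fun h a m => by
    obtain ⟨m, rfl⟩ := Submodule.mkQ_surjective _ m
    exact f.comm h a m)

@[simp] theorem desc_app (S : Sub M) {N : GrMod 𝒜} (f : M ⟶ N) (hf) (n : ℤ) (x : M.X n) :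
    Hom.app (S.desc f hf) n ((S.carrier n).mkQ x : M.X n ⧸ S.carrier n) = Hom.app f n x := rfl

end Sub

/-- The kernel of a morphism. -/
def ker {M N : GrMod 𝒜} (f : M ⟶ N) : Sub M where
  carrier n := LinearMap.ker (Hom.app f n)
  act_mem h a m hm := by
    rw [LinearMap.mem_ker] at *
    rw [f.comm, hm, map_zero]

/-- The image of a morphism. -/
def range {M N : GrMod 𝒜} (f : M ⟶ N) : Sub N where
  carrier n := LinearMap.range (Hom.app f n)
  act_mem h a m hm := by
    obtain ⟨x, rfl⟩ := hm
    exact ⟨_, f.comm h a x⟩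

theorem ker_ι_comp {M N : GrMod 𝒜} (f : M ⟶ N) : (ker f).ι ≫ f = 0 := by
  ext n x
  exact x.2

theorem comp_range_π {M N : GrMod 𝒜} (f : M ⟶ N) : f ≫ (range f).π = 0 := by
  ext n x
  exact (Submodule.Quotient.mk_eq_zero _).2 ⟨x, rfl⟩

theorem app_eq_zero {M N P : GrMod 𝒜} {f : M ⟶ N} {g : N ⟶ P} (h : f ≫ g = 0) (n : ℤ)
    (x : M.X n) : Hom.app g n (Hom.app f n x) = 0 := by
  rw [← comp_app, h, zero_app]

/-- The explicit kernel is a categorical kernel. -/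
def kerIsLimit {M N : GrMod 𝒜} (f : M ⟶ N) :
    IsLimit (KernelFork.ofι (ker f).ι (ker_ι_comp f)) :=
  KernelFork.IsLimit.ofι _ _ (fun g hg => (ker f).lift g (fun n x => app_eq_zero hg n x))
    (fun _ _ => rfl)
    (fun g hg m hm => by
      subst hm
      rfl)

/-- The explicit cokernel is a categorical cokernel. -/
def cokerIsColimit {M N : GrMod 𝒜} (f : M ⟶ N) :
    IsColimit (CokernelCofork.ofπ (range f).π (comp_range_π f)) :=
  CokernelCofork.IsColimit.ofπ _ _
    (fun g hg => (range f).desc g (by rintro n _ ⟨x, rfl⟩; exact app_eq_zero hg n x))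
    (fun _ _ => rfl)
    (fun g hg m hm => by
      subst hm
      ext n x
      obtain ⟨x, rfl⟩ := Submodule.mkQ_surjective _ x
      rfl)

instance : HasKernels (GrMod 𝒜) := ⟨fun f => HasLimit.mk ⟨_, kerIsLimit f⟩⟩
instance : HasCokernels (GrMod 𝒜) := ⟨fun f => HasColimit.mk ⟨_, cokerIsColimit f⟩⟩

theorem injective_of_mono {M N : GrMod 𝒜} (f : M ⟶ N) [Mono f] (n : ℤ) :
    Function.Injective (Hom.app f n) := by
  rw [← LinearMap.ker_eq_bot, LinearMap.ker_eq_bot']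
  intro x hx
  have h : (ker f).ι = 0 := by
    rw [← cancel_mono f, ker_ι_comp, zero_comp]
  exact congrArg (fun g : (ker f).obj ⟶ M => Hom.app g n ⟨x, hx⟩) h

theorem mono_of_injective {M N : GrMod 𝒜} (f : M ⟶ N)
    (hf : ∀ n, Function.Injective (Hom.app f n)) : Mono f where
  right_cancellation g h w := by
    ext n x
    exact hf n (congrArg (fun φ => Hom.app φ n x) w)

theorem surjective_of_epi {M N : GrMod 𝒜} (f : M ⟶ N) [Epi f] (n : ℤ) :
    Function.Surjective (Hom.app f n) := by
  intro y
  have h : (range f).π = 0 := by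
    rw [← cancel_epi f, comp_range_π, comp_zero]
  exact (Submodule.Quotient.mk_eq_zero _).1
    (congrArg (fun g : N ⟶ (range f).quo => Hom.app g n y) h)

/-- A monomorphism is the kernel of its cokernel. -/
@[reducible]
noncomputable def normalMono {M N : GrMod 𝒜} (f : M ⟶ N) [Mono f] : NormalMono f where
  Z := (range f).quo
  g := (range f).π
  w := comp_range_π f
  isLimit := KernelFork.IsLimit.ofι' _ _ fun {A} g hg => by
    have hg' : ∀ n x, Hom.app g n x ∈ LinearMap.range (Hom.app f n) := fun n x =>
      (Submodule.Quotient.mk_eq_zero _).1 (app_eq_zero hg n x)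
    let e := fun n => LinearEquiv.ofInjective (Hom.app f n) (injective_of_mono f n)
    have he : ∀ n (y : LinearMap.range (Hom.app f n)), Hom.app f n ((e n).symm y) = y.1 :=
      fun n y => congrArg Subtype.val ((e n).apply_symm_apply y)
    refine ⟨Hom.mk (fun n => (e n).symm.toLinearMap ∘ₗ (Hom.app g n).codRestrict _ (hg' n))
      (fun h a m => injective_of_mono f _ ?_), ?_⟩
    · rw [f.comm]
      refine (he _ _).trans ((g.comm h a m).trans ?_)
      exact congrArg _ (he _ ⟨_, hg' _ m⟩).symm
    · ext n x
      exact he n _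

/-- An epimorphism is the cokernel of its kernel. -/
@[reducible]
noncomputable def normalEpi {M N : GrMod 𝒜} (f : M ⟶ N) [Epi f] : NormalEpi f where
  W := (ker f).obj
  g := (ker f).ι
  w := ker_ι_comp f
  isColimit := CokernelCofork.IsColimit.ofπ' _ _ fun {A} g hg => by
    have hg' : ∀ n, LinearMap.ker (Hom.app f n) ≤ LinearMap.ker (Hom.app g n) := fun n x hx =>
      app_eq_zero hg n ⟨x, hx⟩
    let e := fun n => (Hom.app f n).quotKerEquivOfSurjective (surjective_of_epi f n)
    let d := fun n => ((LinearMap.ker (Hom.app f n)).liftQ (Hom.app g n) (hg' n)) ∘ₗ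
      (e n).symm.toLinearMap
    have hd : ∀ n x, d n (Hom.app f n x) = Hom.app g n x := by
      intro n x
      have : (e n).symm (Hom.app f n x) = (LinearMap.ker (Hom.app f n)).mkQ x := by
        rw [LinearEquiv.symm_apply_eq]; rfl
      simp [d, this]
    refine ⟨Hom.mk d (fun h a m => ?_), ?_⟩
    · obtain ⟨m, rfl⟩ := surjective_of_epi f _ m
      rw [← f.comm, hd, hd, g.comm]
    · ext n x
      exact hd n x

instance : IsNormalMonoCategory (GrMod 𝒜) := ⟨fun f _ => ⟨normalMono f⟩⟩
instance : IsNormalEpiCategory (GrMod 𝒜) := ⟨fun f _ => ⟨normalEpi f⟩⟩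

/-- The direct sum of two graded modules. -/
@[simps X] def prod (M N : GrMod 𝒜) : GrMod 𝒜 where
  X n := M.X n × N.X n
  act h := LinearMap.mk₂ k (fun a m => (M.act h a m.1, N.act h a m.2))
    (fun _ _ _ => by simp) (fun _ _ _ => by simp) (fun _ _ _ => by simp) (fun _ _ _ => by simp)
  one_act h m := Prod.ext (M.one_act h m.1) (N.one_act h m.2)
  mul_act h h' h'' a b m := Prod.ext (M.mul_act h h' h'' a b m.1) (N.mul_act h h' h'' a b m.2)

/-- The direct sum as a bicone. -/
def bicone (M N : GrMod 𝒜) : BinaryBicone M N where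
  pt := prod M N
  fst := Hom.mk (fun _ => LinearMap.fst k _ _) (fun _ _ _ => rfl)
  snd := Hom.mk (fun _ => LinearMap.snd k _ _) (fun _ _ _ => rfl)
  inl := Hom.mk (fun _ => LinearMap.inl k _ _) (fun h a _ => Prod.ext rfl (map_zero (N.act h a)).symm)
  inr := Hom.mk (fun _ => LinearMap.inr k _ _) (fun h a _ => Prod.ext (map_zero (M.act h a)).symm rfl)
  inl_fst := rfl
  inl_snd := rfl
  inr_fst := rfl
  inr_snd := rfl

instance : HasBinaryBiproducts (GrMod 𝒜) where
  has_binary_biproduct M N := HasBinaryBiproduct.mk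
    { bicone := bicone M N
      isBilimit := isBinaryBilimitOfTotal _ (by
        ext n x
        exact Prod.ext (add_zero _) (zero_add _)) }

/-- The zero graded module. -/
def zeroObj : GrMod 𝒜 where
  X _ := PUnit
  act _ := 0
  one_act _ _ := rfl
  mul_act _ _ _ _ _ _ := rfl

instance : HasZeroObject (GrMod 𝒜) where
  zero := ⟨zeroObj, by
    rw [IsZero.iff_id_eq_zero]
    rfl⟩

instance : HasFiniteProducts (GrMod 𝒜) :=
  hasFiniteProducts_of_has_binary_and_terminal

instance : Abelian (GrMod 𝒜) where

/-- The graded module coinduced from a family of vector spaces `V`; its component in degree `n` is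
`∏ j, Hom_k(𝒜 j, V (j + n))`. -/
def coind (V : ℤ → Type u) [∀ n, AddCommGroup (V n)] [∀ n, Module k (V n)] : GrMod 𝒜 where
  X n := ∀ q : {q : ℕ × ℤ // (q.1 : ℤ) + n = q.2}, (𝒜 q.1.1 →ₗ[k] V q.1.2)
  act {i n l} h := LinearMap.mk₂ k
    (fun b φ q => φ ⟨(q.1.1 + i, q.1.2), by have := q.2; push_cast; omega⟩ ∘ₗ
      LinearMap.codRestrict (𝒜 (q.1.1 + i)) ((LinearMap.mulRight k (b : R)).comp (𝒜 q.1.1).subtype)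
        (fun a => SetLike.GradedMul.mul_mem a.2 b.2))
    (fun b b' φ => by
      funext q
      ext a
      refine Eq.trans ?_ (map_add (φ ⟨(q.1.1 + i, q.1.2), _⟩) _ _)
      exact congrArg (φ _) (Subtype.ext (mul_add _ _ _)))
    (fun c b φ => by
      funext q
      ext a
      refine Eq.trans ?_ (map_smul (φ ⟨(q.1.1 + i, q.1.2), _⟩) _ _)
      exact congrArg (φ _) (Subtype.ext (mul_smul_comm _ _ _)))
    (fun _ _ _ => rfl) (fun _ _ _ => rfl)
  one_act {n} h φ := by
    funext q
    ext a
    exact congrArg (φ q) (Subtype.ext (mul_one _))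
  mul_act {i i' n l p} h h' h'' a b φ := by
    funext q
    ext c
    have key : ∀ (s t : ℕ) (hst : s = t) (r : ℤ) (hs : (s : ℤ) + n = r) (ht : (t : ℤ) + n = r)
        (x : 𝒜 s) (y : 𝒜 t), (x : R) = y → φ ⟨(s, r), hs⟩ x = φ ⟨(t, r), ht⟩ y := by
      rintro s _ rfl r hs ht x y hxy
      rw [Subtype.ext hxy]
    exact key _ _ (add_assoc _ _ _).symm _ _ _ _ _ (mul_assoc _ _ _).symm

/-- The value of an element of the coinduced module at `1`. -/
def coindEv (V : ℤ → Type u) [∀ n, AddCommGroup (V n)] [∀ n, Module k (V n)] (n : ℤ) :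
    (coind (𝒜 := 𝒜) V).X n →ₗ[k] V n :=
  LinearMap.applyₗ (⟨1, SetLike.GradedOne.one_mem⟩ : 𝒜 0) ∘ₗ
    LinearMap.proj (⟨(0, n), by simp⟩ : {q : ℕ × ℤ // (q.1 : ℤ) + n = q.2})

/-- The morphism to a coinduced module attached to a family of linear maps. -/
def coindLift (V : ℤ → Type u) [∀ n, AddCommGroup (V n)] [∀ n, Module k (V n)] {M : GrMod 𝒜}
    (g : ∀ n, M.X n →ₗ[k] V n) : M ⟶ coind V :=
  Hom.mk
    (fun n => LinearMap.pi fun q : {q : ℕ × ℤ // (q.1 : ℤ) + n = q.2} =>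
      LinearMap.compRight k (g q.1.2) ∘ₗ (M.act q.2).flip)
    (fun {i n l} h a m => by
      funext q
      ext b
      exact congrArg (g q.1.2) (M.mul_act h q.2 _ b a m).symm)

theorem coindEv_lift (V : ℤ → Type u) [∀ n, AddCommGroup (V n)] [∀ n, Module k (V n)]
    {M : GrMod 𝒜} (g : ∀ n, M.X n →ₗ[k] V n) (n : ℤ) (m : M.X n) :
    coindEv V n (Hom.app (coindLift (𝒜 := 𝒜) V g) n m) = g n m :=
  congrArg (g n) (M.one_act (by simp) m)

theorem coind_hom_ext (V : ℤ → Type u) [∀ n, AddCommGroup (V n)] [∀ n, Module k (V n)]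
    {M : GrMod 𝒜} (f f' : M ⟶ coind V)
    (h : ∀ n m, coindEv V n (Hom.app f n m) = coindEv V n (Hom.app f' n m)) : f = f' := by
  have key' : ∀ (n r : ℤ) (φ : (coind (𝒜 := 𝒜) V).X n) (s t : ℕ) (hst : s = t)
      (hs : (s : ℤ) + n = r) (ht : (t : ℤ) + n = r) (x : 𝒜 s) (y : 𝒜 t), (x : R) = y →
      (show ∀ q : {q : ℕ × ℤ // (q.1 : ℤ) + n = q.2}, (𝒜 q.1.1 →ₗ[k] V q.1.2) from φ)
          ⟨(s, r), hs⟩ x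
        = (show ∀ q : {q : ℕ × ℤ // (q.1 : ℤ) + n = q.2}, (𝒜 q.1.1 →ₗ[k] V q.1.2) from φ)
          ⟨(t, r), ht⟩ y := by
    rintro n r φ s _ rfl hs ht x y hxy
    rw [Subtype.ext hxy]
  have key : ∀ (F : M ⟶ coind V) (n : ℤ) (m : M.X n)
      (q : {q : ℕ × ℤ // (q.1 : ℤ) + n = q.2}) (a : 𝒜 q.1.1),
      (show ∀ q : {q : ℕ × ℤ // (q.1 : ℤ) + n = q.2}, (𝒜 q.1.1 →ₗ[k] V q.1.2) from
          Hom.app F n m) q a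
        = coindEv V q.1.2 (Hom.app F q.1.2 (M.act q.2 a m)) := by
    intro F n m q a
    rw [F.comm]
    exact key' n _ (Hom.app F n m) _ _ (zero_add _).symm _ _ _ _ (one_mul _).symm
  ext n m
  funext q
  refine LinearMap.ext fun a => ?_
  exact (key f n m q a).trans ((h _ _).trans (key f' n m q a).symm)

instance coind_injective (V : ℤ → Type u) [∀ n, AddCommGroup (V n)] [∀ n, Module k (V n)] :
    Injective (coind (𝒜 := 𝒜) V) where
  factors {A B} g f _ := by
    have h : ∀ n, ∃ r : B.X n →ₗ[k] A.X n, r ∘ₗ Hom.app f n = LinearMap.id := fun n =>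
      LinearMap.exists_leftInverse_of_injective _
        (LinearMap.ker_eq_bot.2 (injective_of_mono f n))
    choose r hr using h
    refine ⟨coindLift V (fun n => coindEv V n ∘ₗ Hom.app g n ∘ₗ r n), ?_⟩
    apply coind_hom_ext
    intro n m
    rw [comp_app, coindEv_lift]
    have : r n (Hom.app f n m) = m := LinearMap.congr_fun (hr n) m
    simp [this]

instance : EnoughInjectives (GrMod 𝒜) where
  presentation M := ⟨{
    J := coind M.X
    injective := inferInstance
    f := coindLift M.X (fun _ => LinearMap.id)
    mono := mono_of_injective _ (fun n x y hxy => by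
      have := congrArg (coindEv M.X n) hxy
      rwa [coindEv_lift, coindEv_lift] at this) }⟩

end Category

section Torsion

variable {k R : Type u} [Field k] [CommRing R] [Algebra k R]
  {𝒜 : ℕ → Submodule k R} [GradedAlgebra 𝒜]

/-- The `I`-torsion submodule: in each degree, the elements killed by some power of `I`. (As `I ^ n`
is homogeneous, it kills `z` if and only if all its homogeneous elements do.) -/
def torsion (I : HomogeneousIdeal 𝒜) (M : GrMod 𝒜) : Sub M where
  carrier j :=
    { carrier := {z | ∃ n : ℕ, ∀ (i : ℕ) (l : ℤ) (h : (i : ℤ) + j = l) (a : 𝒜 i),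
        (a : R) ∈ I.toIdeal ^ n → M.act h a z = 0}
      zero_mem' := ⟨0, fun _ _ _ _ _ => map_zero _⟩
      add_mem' := by
        rintro z w ⟨n, hn⟩ ⟨m, hm⟩
        refine ⟨n + m, fun i l h a ha => ?_⟩
        rw [map_add, hn i l h a (Ideal.pow_le_pow_right (Nat.le_add_right n m) ha),
          hm i l h a (Ideal.pow_le_pow_right (Nat.le_add_left m n) ha), add_zero]
      smul_mem' := by
        rintro c z ⟨n, hn⟩
        exact ⟨n, fun i l h a ha => by rw [map_smul, hn i l h a ha, smul_zero]⟩ }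
  act_mem {i j l} h b z := by
    rintro ⟨n, hn⟩
    refine ⟨n, fun i' l' h' a ha => ?_⟩
    rw [← M.mul_act h h' (by push_cast; omega) a b z]
    exact hn _ _ _ _ (Ideal.mul_mem_right _ _ ha)

/-- The `I`-torsion functor `Γ_I` on graded modules. -/
def Γ (I : HomogeneousIdeal 𝒜) : GrMod 𝒜 ⥤ GrMod 𝒜 where
  obj M := (torsion I M).obj
  map {M N} f := (torsion I N).lift ((torsion I M).ι ≫ f) (by
    rintro j ⟨z, n, hn⟩
    exact ⟨n, fun i l h a ha => by
      refine (f.comm h a z).symm.trans ?_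
      rw [hn i l h a ha, map_zero]⟩)
  map_id _ := rfl
  map_comp _ _ := rfl

instance (I : HomogeneousIdeal 𝒜) : (Γ I).Additive where
  map_add := rfl

/-- Graded local cohomology `H^j_I`, the right derived functors of `Γ_I` on graded modules. -/
noncomputable def localCohomology (I : HomogeneousIdeal 𝒜) (j : ℕ) : GrMod 𝒜 ⥤ GrMod 𝒜 :=
  (Γ I).rightDerived j

end Torsion

end GrMod

/-- `C` is a `G`-acyclic resolution of `A`. -/
structure IsAcyclicResolution {𝒞 : Type*} [Category 𝒞] [Abelian 𝒞] [EnoughInjectives 𝒞]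
    (G : 𝒞 ⥤ 𝒞) [G.Additive] (A : 𝒞) (C : CochainComplex 𝒞 ℕ) : Prop where
  homology_zero : Nonempty (C.homology 0 ≅ A)
  homology_pos : ∀ j : ℕ, j ≠ 0 → IsZero (C.homology j)
  acyclic : ∀ i j : ℕ, j ≠ 0 → IsZero ((G.rightDerived j).obj (C.X i))

/-- The sign `(-1)^i` in the differential of the total complex of `ℕ`-indexed cochain complexes. -/
instance tensorSignsUpNat : ComplexShape.TensorSigns (ComplexShape.up ℕ) where
  ε' := MonoidHom.mk' (fun (i : ℕ) => (-1 : ℤˣ) ^ i) (pow_add (-1 : ℤˣ))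
  rel_add p q r (hpq : p + 1 = q) := by change p + r + 1 = q + r; omega
  add_rel p q r (hpq : p + 1 = q) := by change r + p + 1 = r + q; omega
  ε'_succ := by
    rintro p _ rfl
    exact (pow_succ (-1 : ℤˣ) p).trans (mul_neg_one _)

section Segre

variable {k R S : Type u} [Field k] [CommRing R] [Algebra k R] [CommRing S] [Algebra k S]
  (𝒜 : ℕ → Submodule k R) (ℬ : ℕ → Submodule k S)

/-- The degree `n` component of the Segre product of rings. -/
abbrev SegreComp (n : ℕ) : Type u := 𝒜 n ⊗[k] ℬ n

/-- The inclusion of the components into `R ⊗ S`. -/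
noncomputable def segreIncl (n : ℕ) : SegreComp 𝒜 ℬ n →ₗ[k] R ⊗[k] S :=
  TensorProduct.map (𝒜 n).subtype (ℬ n).subtype

theorem segreIncl_injective (n : ℕ) : Function.Injective (segreIncl 𝒜 ℬ n) :=
  TensorProduct.map_injective_of_flat_flat _ _ (Submodule.injective_subtype _)
    (Submodule.injective_subtype _)

theorem segre_ext {i j : ℕ} (h : i = j) {x : SegreComp 𝒜 ℬ i} {y : SegreComp 𝒜 ℬ j}
    (hxy : segreIncl 𝒜 ℬ i x = segreIncl 𝒜 ℬ j y) :
    (GradedMonoid.mk i x : GradedMonoid (SegreComp 𝒜 ℬ)) = GradedMonoid.mk j y := by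
  subst h
  rw [segreIncl_injective 𝒜 ℬ i hxy]

variable [GradedAlgebra 𝒜] [GradedAlgebra ℬ]

/-- The multiplication `(a ⊗ b) (a' ⊗ b') = a a' ⊗ b b'` of components. -/
noncomputable def segreMul (i j : ℕ) :
    SegreComp 𝒜 ℬ i →ₗ[k] SegreComp 𝒜 ℬ j →ₗ[k] SegreComp 𝒜 ℬ (i + j) :=
  TensorProduct.homTensorHomMap (RingHom.id k) _ _ _ _ ∘ₗ
    TensorProduct.map (DirectSum.gMulLHom k (fun i => 𝒜 i)) (DirectSum.gMulLHom k (fun i => ℬ i))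

theorem segreIncl_mul {i j : ℕ} (x : SegreComp 𝒜 ℬ i) (y : SegreComp 𝒜 ℬ j) :
    segreIncl 𝒜 ℬ (i + j) (segreMul 𝒜 ℬ i j x y) = segreIncl 𝒜 ℬ i x * segreIncl 𝒜 ℬ j y := by
  induction x using TensorProduct.induction_on with
  | zero => simp
  | add x x' hx hx' => simp only [map_add, LinearMap.add_apply, hx, hx', add_mul]
  | tmul a b =>
    induction y using TensorProduct.induction_on with
    | zero => simp
    | add y y' hy hy' => simp only [map_add, hy, hy', mul_add]
    | tmul c d => exact (Algebra.TensorProduct.tmul_mul_tmul (a : R) (c : R) (b : S) (d : S)).symm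

/-- The unit of the Segre product of rings. -/
def segreOne : SegreComp 𝒜 ℬ 0 :=
  (⟨1, SetLike.GradedOne.one_mem⟩ : 𝒜 0) ⊗ₜ[k] (⟨1, SetLike.GradedOne.one_mem⟩ : ℬ 0)

theorem segreIncl_one : segreIncl 𝒜 ℬ 0 (segreOne 𝒜 ℬ) = 1 := rfl

noncomputable instance : GradedMonoid.GMul (SegreComp 𝒜 ℬ) := ⟨fun x y => segreMul 𝒜 ℬ _ _ x y⟩

instance : GradedMonoid.GOne (SegreComp 𝒜 ℬ) := ⟨segreOne 𝒜 ℬ⟩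

noncomputable instance : DirectSum.GCommSemiring (SegreComp 𝒜 ℬ) where
  mul_zero _ := map_zero _
  zero_mul _ := LinearMap.map_zero₂ _ _
  mul_add _ _ _ := map_add _ _ _
  add_mul _ _ _ := LinearMap.map_add₂ _ _ _ _
  one_mul := fun ⟨i, x⟩ => segre_ext 𝒜 ℬ (zero_add i) ((segreIncl_mul 𝒜 ℬ _ _).trans (one_mul _))
  mul_one := fun ⟨i, x⟩ => segre_ext 𝒜 ℬ (add_zero i) ((segreIncl_mul 𝒜 ℬ _ _).trans (mul_one _))
  mul_assoc := fun ⟨i, x⟩ ⟨j, y⟩ ⟨l, z⟩ => segre_ext 𝒜 ℬ (add_assoc i j l) (by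
    refine (segreIncl_mul 𝒜 ℬ (segreMul 𝒜 ℬ i j x y) z).trans (Eq.trans ?_
      (segreIncl_mul 𝒜 ℬ x (segreMul 𝒜 ℬ j l y z)).symm)
    rw [segreIncl_mul, segreIncl_mul, mul_assoc])
  mul_comm := fun ⟨i, x⟩ ⟨j, y⟩ => segre_ext 𝒜 ℬ (add_comm i j) (by
    refine (segreIncl_mul 𝒜 ℬ x y).trans (Eq.trans ?_ (segreIncl_mul 𝒜 ℬ y x).symm)
    exact mul_comm _ _)
  natCast n := n • segreOne 𝒜 ℬ
  natCast_zero := zero_smul _ _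
  natCast_succ n := succ_nsmul _ _

noncomputable instance : DirectSum.GCommRing (SegreComp 𝒜 ℬ) where
  __ := (inferInstance : DirectSum.GCommSemiring (SegreComp 𝒜 ℬ))
  intCast n := n • segreOne 𝒜 ℬ
  intCast_ofNat _ := natCast_zsmul _ _
  intCast_negSucc_ofNat _ := negSucc_zsmul _ _

theorem segreIncl_smul_one (r : k) : segreIncl 𝒜 ℬ 0 (r • segreOne 𝒜 ℬ) = r • 1 := by
  rw [map_smul, segreIncl_one]

noncomputable instance : DirectSum.GAlgebra k (SegreComp 𝒜 ℬ) where
  toFun :=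
    { toFun := fun r => r • segreOne 𝒜 ℬ
      map_zero' := zero_smul k (segreOne 𝒜 ℬ)
      map_add' := fun r s => add_smul r s (segreOne 𝒜 ℬ) }
  map_one := one_smul k (segreOne 𝒜 ℬ)
  map_mul r s := segre_ext 𝒜 ℬ (zero_add 0).symm (by
    refine (segreIncl_smul_one 𝒜 ℬ (r * s)).trans (Eq.trans ?_
      (segreIncl_mul 𝒜 ℬ (r • segreOne 𝒜 ℬ) (s • segreOne 𝒜 ℬ)).symm)
    rw [segreIncl_smul_one, segreIncl_smul_one, smul_mul_smul_comm, one_mul])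
  commutes := fun r ⟨i, x⟩ => segre_ext 𝒜 ℬ (add_comm 0 i) (by
    refine (segreIncl_mul 𝒜 ℬ (r • segreOne 𝒜 ℬ) x).trans (Eq.trans ?_
      (segreIncl_mul 𝒜 ℬ x (r • segreOne 𝒜 ℬ)).symm)
    exact mul_comm _ _)
  smul_def := fun r ⟨i, x⟩ => segre_ext 𝒜 ℬ (zero_add i).symm (by
    refine Eq.trans (map_smul (segreIncl 𝒜 ℬ i) r x) (Eq.trans ?_
      (segreIncl_mul 𝒜 ℬ (r • segreOne 𝒜 ℬ) x).symm)
    rw [segreIncl_smul_one, smul_mul_assoc, one_mul])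

/-- The Segre product `R # S = ⨁ n, R_n ⊗ S_n` of graded rings. -/
abbrev SegreRing : Type u := ⨁ n : ℕ, SegreComp 𝒜 ℬ n

noncomputable instance : CommRing (SegreRing 𝒜 ℬ) := DirectSum.commRing (SegreComp 𝒜 ℬ)

/-- The grading of the Segre product of graded rings. -/
def segreGrading (n : ℕ) : Submodule k (SegreRing 𝒜 ℬ) :=
  LinearMap.range (DirectSum.lof k ℕ (SegreComp 𝒜 ℬ) n)

/-- An element of `R_n ⊗ S_n` as an element of the degree `n` part of `R # S`. -/
def segreOf (n : ℕ) : SegreComp 𝒜 ℬ n →ₗ[k] segreGrading 𝒜 ℬ n :=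
  (DirectSum.lof k ℕ (SegreComp 𝒜 ℬ) n).rangeRestrict

/-- The degree `n` part of `R # S` projects to `R_n ⊗ S_n` (this is inverse to `segreOf`). -/
def segreComponent (n : ℕ) : segreGrading 𝒜 ℬ n →ₗ[k] SegreComp 𝒜 ℬ n :=
  DirectSum.component k ℕ (SegreComp 𝒜 ℬ) n ∘ₗ (segreGrading 𝒜 ℬ n).subtype

noncomputable instance : GradedAlgebra (segreGrading 𝒜 ℬ) where
  one_mem := ⟨segreOne 𝒜 ℬ, rfl⟩
  mul_mem := by
    rintro i j _ _ ⟨x, rfl⟩ ⟨y, rfl⟩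
    exact ⟨segreMul 𝒜 ℬ i j x y, (DirectSum.of_mul_of _ _).symm⟩
  decompose' := DirectSum.toModule k ℕ _ fun n =>
    DirectSum.lof k ℕ (fun n => segreGrading 𝒜 ℬ n) n ∘ₗ segreOf 𝒜 ℬ n
  left_inv t := by
    induction t using DirectSum.induction_on with
    | zero => simp
    | of i x =>
      rw [← DirectSum.lof_eq_of k, DirectSum.toModule_lof]
      exact DirectSum.coeAddMonoidHom_of _ _ _
    | add x y hx hy => rw [map_add, map_add, hx, hy]
  right_inv t := by
    induction t using DirectSum.induction_on with
    | zero => simp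
    | of i x =>
      obtain ⟨_, x, rfl⟩ := x
      rw [DirectSum.coeAddMonoidHom_of, DirectSum.toModule_lof]
      rfl
    | add x y hx hy => rw [map_add, map_add, hx, hy]

variable {𝒜 ℬ}

theorem segre_decompose_apply (t : SegreRing 𝒜 ℬ) (i : ℕ) :
    (DirectSum.decompose (segreGrading 𝒜 ℬ) t i : SegreRing 𝒜 ℬ)
      = DirectSum.of (SegreComp 𝒜 ℬ) i (t i) := by
  induction t using DirectSum.induction_on with
  | zero => simp
  | of j x =>
    have hx : DirectSum.of (SegreComp 𝒜 ℬ) j x ∈ segreGrading 𝒜 ℬ j := ⟨x, rfl⟩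
    rcases eq_or_ne j i with rfl | h
    · rw [DirectSum.decompose_of_mem_same _ hx, DirectSum.of_eq_same]
    · rw [DirectSum.decompose_of_mem_ne _ hx h, DirectSum.of_eq_of_ne _ _ _ h.symm, map_zero]
  | add x y hx hy =>
    rw [DirectSum.decompose_add, DirectSum.add_apply, DirectSum.add_apply, map_add, ← hx, ← hy]
    rfl

variable (𝒜 ℬ) in
theorem segreComponent_mul {i j : ℕ} (x : segreGrading 𝒜 ℬ i) (y : segreGrading 𝒜 ℬ j) :
    segreComponent 𝒜 ℬ (i + j)
        ⟨(x : SegreRing 𝒜 ℬ) * (y : SegreRing 𝒜 ℬ), SetLike.GradedMul.mul_mem x.2 y.2⟩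
      = segreMul 𝒜 ℬ i j (segreComponent 𝒜 ℬ i x) (segreComponent 𝒜 ℬ j y) := by
  obtain ⟨_, x, rfl⟩ := x
  obtain ⟨_, y, rfl⟩ := y
  have hx : (DirectSum.of (SegreComp 𝒜 ℬ) i x) i = x := DirectSum.of_eq_same i x
  have hy : (DirectSum.of (SegreComp 𝒜 ℬ) j y) j = y := DirectSum.of_eq_same j y
  change (DirectSum.of (SegreComp 𝒜 ℬ) i x * DirectSum.of (SegreComp 𝒜 ℬ) j y) (i + j)
    = segreMul 𝒜 ℬ i j ((DirectSum.of (SegreComp 𝒜 ℬ) i x) i) ((DirectSum.of (SegreComp 𝒜 ℬ) j y) j)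
  rw [hx, hy, DirectSum.of_mul_of, DirectSum.of_eq_same]
  rfl

/-- The subspace `I_n ⊗ J_n` of `R_n ⊗ S_n`. -/
def segreIdealComp (I : HomogeneousIdeal 𝒜) (J : HomogeneousIdeal ℬ) (n : ℕ) :
    Submodule k (SegreComp 𝒜 ℬ n) :=
  Submodule.map₂ (TensorProduct.mk k (𝒜 n) (ℬ n))
    ((I.toIdeal.restrictScalars k).comap (𝒜 n).subtype)
    ((J.toIdeal.restrictScalars k).comap (ℬ n).subtype)

theorem segreMul_mem (I : HomogeneousIdeal 𝒜) (J : HomogeneousIdeal ℬ) {i j : ℕ}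
    (x : SegreComp 𝒜 ℬ i) {y : SegreComp 𝒜 ℬ j} (hy : y ∈ segreIdealComp I J j) :
    segreMul 𝒜 ℬ i j x y ∈ segreIdealComp I J (i + j) := by
  suffices h : segreIdealComp I J j ≤ (segreIdealComp I J (i + j)).comap (segreMul 𝒜 ℬ i j x) from
    h hy
  refine Submodule.map₂_le.2 fun a ha b hb => ?_
  induction x using TensorProduct.induction_on with
  | zero => simp
  | add x x' hx hx' =>
    rw [Submodule.mem_comap, map_add, LinearMap.add_apply]
    exact add_mem hx hx'
  | tmul c d =>
    have ha' : (⟨(c : R) * (a : R), SetLike.GradedMul.mul_mem c.2 a.2⟩ : 𝒜 (i + j)) ∈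
        (I.toIdeal.restrictScalars k).comap (𝒜 (i + j)).subtype :=
      I.toIdeal.mul_mem_left (c : R) ha
    have hb' : (⟨(d : S) * (b : S), SetLike.GradedMul.mul_mem d.2 b.2⟩ : ℬ (i + j)) ∈
        (J.toIdeal.restrictScalars k).comap (ℬ (i + j)).subtype :=
      J.toIdeal.mul_mem_left (d : S) hb
    exact Submodule.apply_mem_map₂ _ ha' hb'

theorem segre_of_mem (I : HomogeneousIdeal 𝒜) (J : HomogeneousIdeal ℬ) {i : ℕ}
    {x : SegreComp 𝒜 ℬ i} (hx : x ∈ segreIdealComp I J i) (n : ℕ) :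
    DirectSum.of (SegreComp 𝒜 ℬ) i x n ∈ segreIdealComp I J n := by
  rcases eq_or_ne i n with rfl | h
  · rwa [DirectSum.of_eq_same]
  · rw [DirectSum.of_eq_of_ne _ _ _ h.symm]
    exact zero_mem _

/-- The homogeneous ideal `I # J = ⨁ n, I_n ⊗ J_n` of `R # S`. -/
def segreIdeal (I : HomogeneousIdeal 𝒜) (J : HomogeneousIdeal ℬ) :
    HomogeneousIdeal (segreGrading 𝒜 ℬ) where
  carrier := {t | ∀ n, t n ∈ segreIdealComp I J n}
  zero_mem' _ := zero_mem _
  add_mem' hx hy n := add_mem (hx n) (hy n)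
  smul_mem' c t ht n := by
    classical
    rw [smul_eq_mul, ← DirectSum.sum_support_of t, Finset.mul_sum, DFinsupp.finsetSum_apply]
    refine sum_mem fun j _ => ?_
    induction c using DirectSum.induction_on with
    | zero => rw [zero_mul]; exact zero_mem _
    | of i x =>
      rw [DirectSum.of_mul_of]
      exact segre_of_mem I J (segreMul_mem I J x (ht j)) n
    | add x y hx hy => rw [add_mul]; exact add_mem hx hy
  is_homogeneous' i t ht n := by
    rw [segre_decompose_apply]
    exact segre_of_mem I J (ht i) n

namespace GrMod

/-- The action of the degree `i` part of `R # S` on components of the Segre product of modules,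
`(a ⊗ b) (m ⊗ n) = a m ⊗ b n`. -/
noncomputable def segreAct (M : GrMod 𝒜) (N : GrMod ℬ) {i : ℕ} {j l : ℤ} (h : (i : ℤ) + j = l) :
    SegreComp 𝒜 ℬ i →ₗ[k] (M.X j ⊗[k] N.X j) →ₗ[k] (M.X l ⊗[k] N.X l) :=
  TensorProduct.homTensorHomMap (RingHom.id k) _ _ _ _ ∘ₗ TensorProduct.map (M.act h) (N.act h)

theorem segreAct_one (M : GrMod 𝒜) (N : GrMod ℬ) {j : ℤ} (h : ((0 : ℕ) : ℤ) + j = j)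
    (z : M.X j ⊗[k] N.X j) : segreAct M N h (segreOne 𝒜 ℬ) z = z := by
  induction z using TensorProduct.induction_on with
  | zero => exact map_zero _
  | add z w hz hw => rw [map_add, hz, hw]
  | tmul m n => exact congrArg₂ (fun m n => m ⊗ₜ[k] n) (M.one_act h m) (N.one_act h n)

theorem segreAct_mul (M : GrMod 𝒜) (N : GrMod ℬ) {i i' : ℕ} {j l p : ℤ}
    (h : (i' : ℤ) + j = l) (h' : (i : ℤ) + l = p) (h'' : ((i + i' : ℕ) : ℤ) + j = p)
    (x : SegreComp 𝒜 ℬ i) (y : SegreComp 𝒜 ℬ i') (z : M.X j ⊗[k] N.X j) :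
    segreAct M N h'' (segreMul 𝒜 ℬ i i' x y) z = segreAct M N h' x (segreAct M N h y z) := by
  induction z using TensorProduct.induction_on with
  | zero => simp only [map_zero]
  | add z w hz hw => simp only [map_add, hz, hw]
  | tmul m n =>
    induction x using TensorProduct.induction_on with
    | zero => simp only [map_zero, LinearMap.zero_apply]
    | add x x' hx hx' => simp only [map_add, LinearMap.add_apply, hx, hx']
    | tmul a b =>
      induction y using TensorProduct.induction_on with
      | zero => simp only [map_zero, LinearMap.zero_apply]
      | add y y' hy hy' => simp only [map_add, LinearMap.add_apply, hy, hy']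
      | tmul a' b' =>
        exact congrArg₂ (fun m n => m ⊗ₜ[k] n) (M.mul_act h h' h'' a a' m) (N.mul_act h h' h'' b b' n)

/-- The Segre product `M # N = ⨁ n, M_n ⊗ N_n`. -/
noncomputable def segreObj (M : GrMod 𝒜) (N : GrMod ℬ) : GrMod (segreGrading 𝒜 ℬ) where
  X n := M.X n ⊗[k] N.X n
  act h := segreAct M N h ∘ₗ segreComponent 𝒜 ℬ _
  one_act h z := by
    refine Eq.trans (congrArg (fun t => segreAct M N h t z) ?_) (segreAct_one M N h z)
    exact DirectSum.of_eq_same 0 (segreOne 𝒜 ℬ)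
  mul_act {i i' j l p} h h' h'' x y z := by
    refine Eq.trans (congrArg (fun t => segreAct M N h'' t z) ?_)
      (segreAct_mul M N h h' h'' (segreComponent 𝒜 ℬ i x) (segreComponent 𝒜 ℬ i' y) z)
    exact segreComponent_mul 𝒜 ℬ x y

/-- The Segre product `f # g` of morphisms. -/
noncomputable def segreMap {M M' : GrMod 𝒜} {N N' : GrMod ℬ} (f : M ⟶ M') (g : N ⟶ N') :
    segreObj M N ⟶ segreObj M' N' :=
  Hom.mk (fun n => TensorProduct.map (Hom.app f n) (Hom.app g n)) (fun {i j l} h t z => by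
    change TensorProduct.map (Hom.app f l) (Hom.app g l) (segreAct M N h (segreComponent 𝒜 ℬ i t) z)
      = segreAct M' N' h (segreComponent 𝒜 ℬ i t) (TensorProduct.map (Hom.app f j) (Hom.app g j) z)
    generalize segreComponent 𝒜 ℬ i t = x
    induction z using TensorProduct.induction_on with
    | zero => simp only [map_zero]
    | add z w hz hw => simp only [map_add, hz, hw]
    | tmul m n =>
      induction x using TensorProduct.induction_on with
      | zero => simp only [map_zero, LinearMap.zero_apply]
      | add x x' hx hx' => simp only [map_add, LinearMap.add_apply, hx, hx']
      | tmul a b => exact congrArg₂ (fun m n => m ⊗ₜ[k] n) (f.comm h a m) (g.comm h b n))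

theorem segreMap_app {M M' : GrMod 𝒜} {N N' : GrMod ℬ} (f : M ⟶ M') (g : N ⟶ N') (n : ℤ) :
    Hom.app (segreMap f g) n = TensorProduct.map (Hom.app f n) (Hom.app g n) := rfl

theorem segreMap_id (M : GrMod 𝒜) (N : GrMod ℬ) : segreMap (𝟙 M) (𝟙 N) = 𝟙 (segreObj M N) :=
  Hom.ext (funext fun _ => TensorProduct.map_id)

theorem segreMap_comp {M M' M'' : GrMod 𝒜} {N N' N'' : GrMod ℬ} (f : M ⟶ M') (f' : M' ⟶ M'')
    (g : N ⟶ N') (g' : N' ⟶ N'') :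
    segreMap (f ≫ f') (g ≫ g') = segreMap f g ≫ segreMap f' g' :=
  Hom.ext (funext fun _ => TensorProduct.map_comp _ _ _ _)

variable (𝒜 ℬ) in
/-- The Segre product as a bifunctor. -/
noncomputable def segre : GrMod 𝒜 ⥤ GrMod ℬ ⥤ GrMod (segreGrading 𝒜 ℬ) where
  obj M :=
    { obj := fun N => segreObj M N
      map := fun g => segreMap (𝟙 M) g
      map_id := fun N => segreMap_id M N
      map_comp := fun g g' => by rw [← segreMap_comp, Category.comp_id] }
  map f :=
    { app := fun N => segreMap f (𝟙 N)
      naturality := fun N N' g => by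
        change segreMap _ _ ≫ segreMap _ _ = segreMap _ _ ≫ segreMap _ _
        simp only [← segreMap_comp, Category.comp_id, Category.id_comp] }
  map_id M := by
    ext N : 2
    exact segreMap_id M N
  map_comp f f' := by
    ext N : 2
    change segreMap _ _ = segreMap _ _ ≫ segreMap _ _
    rw [← segreMap_comp, Category.comp_id]

instance (M : GrMod 𝒜) : ((segre 𝒜 ℬ).obj M).Additive where
  map_add := Hom.ext (funext fun _ => TensorProduct.map_add_right _ _ _)

instance : (segre 𝒜 ℬ).Additive where
  map_add {_ _ f f'} := by
    ext N : 2
    exact Hom.ext (funext fun _ => TensorProduct.map_add_left _ _ _)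

instance (E : CochainComplex (GrMod 𝒜) ℕ) (F : CochainComplex (GrMod ℬ) ℕ) :
    HomologicalComplex.HasMapBifunctor E F (segre 𝒜 ℬ) (ComplexShape.up ℕ) := by
  intro n
  have : Finite (ComplexShape.π (ComplexShape.up ℕ) (ComplexShape.up ℕ) (ComplexShape.up ℕ) ⁻¹'
      {n}) := by
    refine Set.Finite.subset (Finset.HasAntidiagonal.antidiagonal n).finite_toSet ?_
    rintro ⟨i, j⟩ hij
    exact Finset.mem_coe.2 (Finset.HasAntidiagonal.mem_antidiagonal.2 hij)
  infer_instance

/-- The Segre product `E # F` of complexes: its term in degree `n` is `⨁_{i + j = n} E^i # F^j`, and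
its differential is `d # id + (-1)^i (id # d)` on `E^i # F^j`. -/
noncomputable def segreComplex (E : CochainComplex (GrMod 𝒜) ℕ) (F : CochainComplex (GrMod ℬ) ℕ) :
    CochainComplex (GrMod (segreGrading 𝒜 ℬ)) ℕ :=
  HomologicalComplex.mapBifunctor E F (segre 𝒜 ℬ) (ComplexShape.up ℕ)

end GrMod

end Segre

/-!
The idea is to replace injective modules by a class of graded modules that is stable under Segre
products and still computes local cohomology. For a list `L = x₁, …, xᵣ` of homogeneous elements,
a graded module `M` is called flasque along `L` (`GrMod.IsFlasque`) if each `Γ_{x₁, …, xᵢ₋₁}(M)`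
surjects onto its localization at `xᵢ`.

*Injective modules are flasque.* An injective graded module over a graded Noetherian ring satisfies
the graded form of Baer's condition (`GrMod.isBaer_of_injective`: it is a retract of a coinduced
module, for which the condition is the extension of linear maps over `k`). Baer's condition implies
surjectivity onto `M_x`, because the annihilators of the powers of `x` stabilize, and it passes from
`M` to `Γ_x(M)`, because of the Artin–Rees property of the powers of `x`. Hence a module satisfying
it is flasque along every list (`GrMod.IsBaer.isFlasque`).

*Segre products of flasque modules are flasque.* Over a field,
`Γ_{a ⊗ b}(M # N) = Γ_a(M) # N + M # Γ_b(N)` with intersection `Γ_a(M) # Γ_b(N)`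
(`GrMod.isShortExact_segreTorsion`). In a short exact sequence, flasqueness of the first two modules
implies that of the third, so an induction on the list shows that `M # N` is flasque along every
list of elements `a ⊗ b` (`GrMod.isFlasque_segreObj`). The ideal `I # J` is generated by finitely
many such elements, as `R # S` is Noetherian (`exists_span_eq_segreIdeal`).

*Flasque resolutions compute local cohomology.* In an exact complex of flasque modules bounded
below, all modules of cocycles are flasque, so that torsion along `L` keeps the complex exact
(`GrMod.exists_torsion_primitive`). Applied to the mapping cone of a morphism from a flasque
resolution to an injective one, this gives `GrMod.nonempty_homology_iso_localCohomology`; applied to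
a flasque module as a resolution of itself, it gives the vanishing `GrMod.isZero_localCohomology`.

*The Segre product of resolutions is a resolution.* As `#` is exact in both variables, the rows
`0 → Eⁱ # N → Eⁱ # F⁰ → Eⁱ # F¹ → ⋯` are exact. A cocycle of the total complex can therefore be
moved by coboundaries into the column `E # F⁰`, where it comes from the resolution `E # N` of
`M # N` (`GrMod.isResolution_segreComplex`).
-/

/-! ### Powers of a homogeneous element and their torsion -/

namespace GrMod

section Flasque

variable {k R : Type u} [Field k] [CommRing R] [Algebra k R]
  {𝒜 : ℕ → Submodule k R} [GradedAlgebra 𝒜]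

theorem act_congr (M : GrMod 𝒜) {i i' : ℕ} (hi : i = i') {a : 𝒜 i} {a' : 𝒜 i'}
    (ha : (a : R) = a') {j l : ℤ} (h : (i : ℤ) + j = l) (h' : (i' : ℤ) + j = l) (m : M.X j) :
    M.act h a m = M.act h' a' m := by
  subst hi
  rw [Subtype.ext ha]

theorem act_act (M : GrMod 𝒜) {i i' q : ℕ} (hq : q = i + i') {a : 𝒜 i} {b : 𝒜 i'} {c : 𝒜 q}
    (hc : (c : R) = a * b) {j l p : ℤ} (h : (i' : ℤ) + j = l) (h' : (i : ℤ) + l = p)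
    (h'' : (q : ℤ) + j = p) (m : M.X j) :
    M.act h' a (M.act h b m) = M.act h'' c m := by
  subst hq
  rw [← M.mul_act h h' h'' a b m]
  exact M.act_congr rfl hc.symm _ _ m

theorem act_act_comm (M : GrMod 𝒜) {i i' : ℕ} (a : 𝒜 i) (b : 𝒜 i') {j l l' p : ℤ}
    (h : (i' : ℤ) + j = l) (h' : (i : ℤ) + l = p) (h₁ : (i : ℤ) + j = l')
    (h₁' : (i' : ℤ) + l' = p) (m : M.X j) :
    M.act h' a (M.act h b m) = M.act h₁' b (M.act h₁ a m) := by
  have h'' : ((i + i' : ℕ) : ℤ) + j = p := by push_cast; omega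
  rw [M.act_act rfl (c := ⟨(a : R) * b, SetLike.GradedMul.mul_mem a.2 b.2⟩) rfl h h' h'',
    M.act_act (add_comm i i') (c := ⟨(a : R) * b, SetLike.GradedMul.mul_mem a.2 b.2⟩)
      (mul_comm _ _) h₁ h₁' h'']

/-- The power `x ^ e` of a homogeneous element of degree `n`, as an element of degree `e * n`. -/
def homPow {n : ℕ} (x : 𝒜 n) (e : ℕ) : 𝒜 (e * n) :=
  ⟨(x : R) ^ e, SetLike.pow_mem_graded e x.2⟩

/-- Multiplication by the power `x ^ e` of a homogeneous element `x` of degree `n`. -/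
def powAct (M : GrMod 𝒜) {n : ℕ} (x : 𝒜 n) (e : ℕ) {j l : ℤ} (h : ((e * n : ℕ) : ℤ) + j = l) :
    M.X j →ₗ[k] M.X l :=
  M.act h (homPow x e)

theorem powAct_powAct (M : GrMod 𝒜) {n : ℕ} (x : 𝒜 n) {e e' f : ℕ} (hf : f = e + e') {j l p : ℤ}
    (h : ((e' * n : ℕ) : ℤ) + j = l) (h' : ((e * n : ℕ) : ℤ) + l = p)
    (h'' : ((f * n : ℕ) : ℤ) + j = p) (m : M.X j) :
    M.powAct x e h' (M.powAct x e' h m) = M.powAct x f h'' m := by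
  subst hf
  exact M.act_act (add_mul _ _ _) (pow_add _ _ _) _ _ _ _

theorem powAct_act (M : GrMod 𝒜) {n i : ℕ} (x : 𝒜 n) (e : ℕ) (a : 𝒜 i) {j l l' p : ℤ}
    (h : (i : ℤ) + j = l) (h' : ((e * n : ℕ) : ℤ) + l = p) (h₁ : ((e * n : ℕ) : ℤ) + j = l')
    (h₁' : (i : ℤ) + l' = p) (m : M.X j) :
    M.powAct x e h' (M.act h a m) = M.act h₁' a (M.powAct x e h₁ m) :=
  M.act_act_comm _ _ _ _ _ _ _

theorem powAct_zero (M : GrMod 𝒜) {n : ℕ} (x : 𝒜 n) {j : ℤ} (h : ((0 * n : ℕ) : ℤ) + j = j)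
    (m : M.X j) : M.powAct x 0 h m = m :=
  (M.act_congr (zero_mul n) (pow_zero (x : R)) h (by simp) m).trans (M.one_act (by simp) m)

theorem powAct_one (M : GrMod 𝒜) {n : ℕ} (x : 𝒜 n) {j l : ℤ} (h : ((1 * n : ℕ) : ℤ) + j = l)
    (h' : (n : ℤ) + j = l) (m : M.X j) : M.powAct x 1 h m = M.act h' x m :=
  M.act_congr (one_mul n) (pow_one (x : R)) h h' m

theorem app_powAct {M N : GrMod 𝒜} (f : M ⟶ N) {n : ℕ} (x : 𝒜 n) (e : ℕ) {j l : ℤ}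
    (h : ((e * n : ℕ) : ℤ) + j = l) (m : M.X j) :
    Hom.app f l (M.powAct x e h m) = N.powAct x e h (Hom.app f j m) :=
  f.comm _ _ _

theorem powAct_eq_zero_of_le (M : GrMod 𝒜) {n : ℕ} (x : 𝒜 n) {e e' : ℕ} (he : e ≤ e') {j : ℤ}
    {m : M.X j} (hm : ∀ l h, M.powAct x e (l := l) h m = 0) (l : ℤ)
    (h : ((e' * n : ℕ) : ℤ) + j = l) : M.powAct x e' h m = 0 := by
  obtain ⟨c, rfl⟩ := Nat.exists_eq_add_of_le he
  have h' : ((c * n : ℕ) : ℤ) + (((e * n : ℕ) : ℤ) + j) = l := by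
    rw [← h]; push_cast; ring
  rw [← M.powAct_powAct x (add_comm e c) rfl h' h m, hm, map_zero]

/-- The submodule of elements killed by some power of the homogeneous element `x`. -/
def powTorsion (M : GrMod 𝒜) {n : ℕ} (x : 𝒜 n) : Sub M where
  carrier j :=
    { carrier := {z | ∃ e : ℕ, ∀ (l : ℤ) (h : ((e * n : ℕ) : ℤ) + j = l), M.powAct x e h z = 0}
      zero_mem' := ⟨0, fun _ _ => map_zero _⟩
      add_mem' := by
        rintro z w ⟨e, he⟩ ⟨e', he'⟩
        refine ⟨e + e', fun l h => ?_⟩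
        rw [map_add, M.powAct_eq_zero_of_le x (Nat.le_add_right e e') he,
          M.powAct_eq_zero_of_le x (Nat.le_add_left e' e) he', add_zero]
      smul_mem' := by
        rintro c z ⟨e, he⟩
        exact ⟨e, fun l h => by rw [map_smul, he, smul_zero]⟩ }
  act_mem {i j l} h b z := by
    rintro ⟨e, he⟩
    refine ⟨e, fun p h' => ?_⟩
    rw [M.powAct_act x e b h h' rfl (by omega), he, map_zero]

theorem mem_powTorsion_of_powAct {M : GrMod 𝒜} {n : ℕ} {x : 𝒜 n} {j l : ℤ} {z : M.X j} {e : ℕ}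
    (h : ((e * n : ℕ) : ℤ) + j = l) (hz : M.powAct x e h z ∈ (M.powTorsion x).carrier l) :
    z ∈ (M.powTorsion x).carrier j := by
  obtain ⟨c, hc⟩ := hz
  refine ⟨c + e, fun p h' => ?_⟩
  rw [← M.powAct_powAct x rfl h (by rw [← h', ← h]; push_cast; ring) h', hc]

theorem mem_powTorsion_of_eq_zero {M : GrMod 𝒜} {n : ℕ} {x : 𝒜 n} {j l : ℤ} {z : M.X j} {e : ℕ}
    (h : ((e * n : ℕ) : ℤ) + j = l) (hz : M.powAct x e h z = 0) :
    z ∈ (M.powTorsion x).carrier j :=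
  mem_powTorsion_of_powAct h (hz ▸ zero_mem _)

theorem app_mem_powTorsion {M N : GrMod 𝒜} (f : M ⟶ N) {n : ℕ} {x : 𝒜 n} {j : ℤ} {z : M.X j}
    (hz : z ∈ (M.powTorsion x).carrier j) : Hom.app f j z ∈ (N.powTorsion x).carrier j := by
  obtain ⟨e, he⟩ := hz
  exact ⟨e, fun l h => by rw [← app_powAct, he, map_zero]⟩

theorem mem_powTorsion_of_app {M N : GrMod 𝒜} (f : M ⟶ N)
    (hf : ∀ n, Function.Injective (Hom.app f n)) {n : ℕ} {x : 𝒜 n} {j : ℤ} {z : M.X j}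
    (hz : Hom.app f j z ∈ (N.powTorsion x).carrier j) : z ∈ (M.powTorsion x).carrier j := by
  obtain ⟨e, he⟩ := hz
  exact ⟨e, fun l h => hf _ (by rw [app_powAct, he, map_zero])⟩

/-- The morphism induced on `x`-power torsion. -/
def powTorsionMap {M N : GrMod 𝒜} (f : M ⟶ N) {n : ℕ} (x : 𝒜 n) :
    (M.powTorsion x).obj ⟶ (N.powTorsion x).obj :=
  (N.powTorsion x).lift ((M.powTorsion x).ι ≫ f) (fun _ z => app_mem_powTorsion f z.2)

/-- The localization map `M → M_x` is surjective. As `M_x` is the union of the `x ^ (-e) M`, this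
means that multiplication by every `x ^ e` is surjective modulo `x`-power torsion. -/
def IsDivisible (M : GrMod 𝒜) {n : ℕ} (x : 𝒜 n) : Prop :=
  ∀ (e : ℕ) {j l : ℤ} (h : ((e * n : ℕ) : ℤ) + j = l) (m : M.X l),
    ∃ m' : M.X j, M.powAct x e h m' - m ∈ (M.powTorsion x).carrier l

/-- A graded module `M` is flasque along the list `x₁, …, xᵣ` of homogeneous elements if each
`Γ_{x₁, …, xᵢ₋₁}(M)` surjects onto its localization at `xᵢ`. -/
def IsFlasque : List (Σ n, 𝒜 n) → GrMod 𝒜 → Prop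
  | [], _ => True
  | x :: L, M => M.IsDivisible x.2 ∧ IsFlasque L (M.powTorsion x.2).obj

/-- A short exact sequence `0 → M' → M → M'' → 0` of graded modules, in terms of elements. -/
structure IsShortExact {M' M M'' : GrMod 𝒜} (f : M' ⟶ M) (g : M ⟶ M'') : Prop where
  inj : ∀ n, Function.Injective (Hom.app f n)
  zero : ∀ n z, Hom.app g n (Hom.app f n z) = 0
  exact : ∀ n z, Hom.app g n z = 0 → ∃ y, Hom.app f n y = z
  surj : ∀ n, Function.Surjective (Hom.app g n)

namespace IsShortExact

variable {M' M M'' : GrMod 𝒜} {f : M' ⟶ M} {g : M ⟶ M''}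

/-- Torsion elements lift along an epimorphism whose kernel surjects onto its localization. -/
theorem exists_lift_powTorsion (hfg : IsShortExact f g) {n : ℕ} {x : 𝒜 n} (hx : M'.IsDivisible x)
    {j : ℤ} {z : M''.X j} (hz : z ∈ (M''.powTorsion x).carrier j) :
    ∃ y ∈ (M.powTorsion x).carrier j, Hom.app g j y = z := by
  obtain ⟨e, he⟩ := hz
  obtain ⟨y, rfl⟩ := hfg.surj j z
  obtain ⟨w, hw⟩ := hfg.exact _ (M.powAct x e rfl y) (by rw [app_powAct, he])
  obtain ⟨v, hv⟩ := hx e rfl w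
  refine ⟨y - Hom.app f j v, mem_powTorsion_of_powAct (e := e) rfl ?_, ?_⟩
  · rw [map_sub, ← hw, ← app_powAct, ← map_sub]
    refine app_mem_powTorsion f ?_
    rw [← neg_sub]
    exact neg_mem hv
  · rw [map_sub, hfg.zero, sub_zero]

theorem powTorsion (hfg : IsShortExact f g) {n : ℕ} {x : 𝒜 n} (hx : M'.IsDivisible x) :
    IsShortExact (powTorsionMap f x) (powTorsionMap g x) where
  inj n y z h := Subtype.ext (hfg.inj n (congrArg Subtype.val h))
  zero n z := Subtype.ext (hfg.zero n z.1)
  exact n z h := by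
    obtain ⟨y, hy⟩ := hfg.exact n z.1 (congrArg Subtype.val h)
    exact ⟨⟨y, mem_powTorsion_of_app f hfg.inj (hy ▸ z.2)⟩, Subtype.ext hy⟩
  surj n z := by
    obtain ⟨y, hy, h⟩ := hfg.exists_lift_powTorsion hx z.2
    exact ⟨⟨y, hy⟩, Subtype.ext h⟩

theorem isDivisible_right (hfg : IsShortExact f g) {n : ℕ} {x : 𝒜 n} (hx : M.IsDivisible x) :
    M''.IsDivisible x := by
  intro e j l h m
  obtain ⟨m, rfl⟩ := hfg.surj _ m
  obtain ⟨m', hm'⟩ := hx e h m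
  refine ⟨Hom.app g j m', ?_⟩
  rw [← app_powAct, ← map_sub]
  exact app_mem_powTorsion g hm'

theorem isDivisible_mid (hfg : IsShortExact f g) {n : ℕ} {x : 𝒜 n} (hx : M'.IsDivisible x)
    (hx' : M''.IsDivisible x) : M.IsDivisible x := by
  intro e j l h m
  obtain ⟨w, hw⟩ := hx' e h (Hom.app g l m)
  obtain ⟨w, rfl⟩ := hfg.surj _ w
  rw [← app_powAct, ← map_sub] at hw
  obtain ⟨t, ht, htw⟩ := hfg.exists_lift_powTorsion hx hw
  obtain ⟨v, hv⟩ := hfg.exact _ (t - (M.powAct x e h w - m)) (by rw [map_sub, htw, sub_self])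
  obtain ⟨u, hu⟩ := hx e h v
  refine ⟨w + Hom.app f j u, ?_⟩
  have : M.powAct x e h (w + Hom.app f j u) - m
      = t + Hom.app f l (M'.powAct x e h u - v) := by
    rw [map_add, map_sub, hv, app_powAct]
    abel
  rw [this]
  exact add_mem ht (app_mem_powTorsion f hu)

theorem isFlasque_right (hfg : IsShortExact f g) {L : List (Σ n, 𝒜 n)} (h' : IsFlasque L M')
    (h : IsFlasque L M) : IsFlasque L M'' := by
  induction L generalizing M' M M'' with
  | nil => trivial
  | cons x L ih => exact ⟨hfg.isDivisible_right h.1, ih (hfg.powTorsion h'.1) h'.2 h.2⟩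

theorem isFlasque_mid (hfg : IsShortExact f g) {L : List (Σ n, 𝒜 n)} (h' : IsFlasque L M')
    (h'' : IsFlasque L M'') : IsFlasque L M := by
  induction L generalizing M' M M'' with
  | nil => trivial
  | cons x L ih => exact ⟨hfg.isDivisible_mid h'.1 h''.1, ih (hfg.powTorsion h'.1) h'.2 h''.2⟩

/-- If `M'` is flasque along `x₁, …, xᵣ`, then `Γ_{x₁, …, xᵣ}(M) → Γ_{x₁, …, xᵣ}(M'')` is
surjective. -/
theorem exists_lift_of_isFlasque (hfg : IsShortExact f g) {L : List (Σ n, 𝒜 n)}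
    (h' : IsFlasque L M') {j : ℤ} {z : M''.X j}
    (hz : ∀ x ∈ L, z ∈ (M''.powTorsion x.2).carrier j) :
    ∃ y, (∀ x ∈ L, y ∈ (M.powTorsion x.2).carrier j) ∧ Hom.app g j y = z := by
  induction L generalizing M' M M'' with
  | nil =>
    obtain ⟨y, hy⟩ := hfg.surj _ z
    exact ⟨y, by simp, hy⟩
  | cons x L ih =>
    have hx := hz x List.mem_cons_self
    obtain ⟨y, hy, hyz⟩ := ih (hfg.powTorsion h'.1) h'.2 (z := ⟨z, hx⟩) (fun w hw =>
      mem_powTorsion_of_app (M''.powTorsion x.2).ι (fun _ => Subtype.val_injective)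
        (hz w (List.mem_cons_of_mem _ hw)))
    refine ⟨y.1, ?_, congrArg Subtype.val hyz⟩
    intro w hw
    rcases List.mem_cons.1 hw with rfl | hw
    · exact y.2
    · exact app_mem_powTorsion (M.powTorsion x.2).ι (hy w hw)

end IsShortExact

/-- A retract of a finite direct sum of modules surjecting onto their localizations. -/
theorem isDivisible_of_sum_eq_id {ι : Type*} (s : Finset ι) {X : GrMod 𝒜} {Y : ι → GrMod 𝒜}
    (i : ∀ a, Y a ⟶ X) (p : ∀ a, X ⟶ Y a)
    (hip : ∀ n z, ∑ a ∈ s, Hom.app (i a) n (Hom.app (p a) n z) = z) {n : ℕ} {x : 𝒜 n}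
    (hY : ∀ a ∈ s, (Y a).IsDivisible x) : X.IsDivisible x := by
  classical
  intro e j l h m
  have : ∀ a, ∃ y : (Y a).X j, a ∈ s →
      (Y a).powAct x e h y - Hom.app (p a) l m ∈ ((Y a).powTorsion x).carrier l := fun a => by
    by_cases ha : a ∈ s
    · obtain ⟨y, hy⟩ := hY a ha e h (Hom.app (p a) l m)
      exact ⟨y, fun _ => hy⟩
    · exact ⟨0, fun h => (ha h).elim⟩
  choose y hy using this
  refine ⟨∑ a ∈ s, Hom.app (i a) j (y a), ?_⟩
  have hsum : X.powAct x e h (∑ a ∈ s, Hom.app (i a) j (y a)) - m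
      = ∑ a ∈ s, Hom.app (i a) l ((Y a).powAct x e h (y a) - Hom.app (p a) l m) := by
    simp only [map_sub, Finset.sum_sub_distrib, hip, map_sum, app_powAct]
  rw [hsum]
  exact sum_mem fun a ha => app_mem_powTorsion (i a) (hy a ha)

theorem isFlasque_of_sum_eq_id {ι : Type*} (s : Finset ι) {X : GrMod 𝒜} {Y : ι → GrMod 𝒜}
    (i : ∀ a, Y a ⟶ X) (p : ∀ a, X ⟶ Y a)
    (hip : ∀ n z, ∑ a ∈ s, Hom.app (i a) n (Hom.app (p a) n z) = z) {L : List (Σ n, 𝒜 n)}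
    (hY : ∀ a ∈ s, IsFlasque L (Y a)) : IsFlasque L X := by
  induction L generalizing X Y with
  | nil => trivial
  | cons x L ih =>
    refine ⟨isDivisible_of_sum_eq_id s i p hip fun a ha => (hY a ha).1,
      ih (fun a => powTorsionMap (i a) x.2) (fun a => powTorsionMap (p a) x.2) (fun n z => ?_)
        fun a ha => (hY a ha).2⟩
    refine Subtype.ext (Eq.trans ?_ (hip n z.1))
    exact map_sum ((X.powTorsion x.2).carrier n).subtype _ _

theorem isFlasque_of_subsingleton {X : GrMod 𝒜} (hX : ∀ n, Subsingleton (X.X n))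
    (L : List (Σ n, 𝒜 n)) : IsFlasque L X :=
  isFlasque_of_sum_eq_id (ι := Empty) ∅ (Y := fun _ => X) (fun a => a.elim) (fun a => a.elim)
    (fun n _ => (hX n).elim _ _) (fun a => a.elim)

theorem isFlasque_prod {X Y : GrMod 𝒜} {L : List (Σ n, 𝒜 n)} (hX : IsFlasque L X)
    (hY : IsFlasque L Y) : IsFlasque L (prod X Y) := by
  refine IsShortExact.isFlasque_mid (f := (bicone X Y).inl) (g := (bicone X Y).snd) ?_ hX hY
  exact
    { inj := fun n a b h => congrArg Prod.fst h
      zero := fun n z => rfl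
      exact := fun n z h => ⟨z.1, Prod.ext rfl (Eq.symm h)⟩
      surj := fun n z => ⟨(0, z), rfl⟩ }

/-- Torsion along a list of elements is exact on an exact sequence `0 → K 0 → K 1 → ⋯` of flasque
modules, because all modules of cocycles are flasque. -/
theorem exists_torsion_primitive {L : List (Σ n, 𝒜 n)} (K : ℕ → GrMod 𝒜)
    (d : ∀ n, K n ⟶ K (n + 1)) (hK : ∀ n, IsFlasque L (K n))
    (d_zero : ∀ j, Function.Injective (Hom.app (d 0) j))
    (d_d : ∀ n j z, Hom.app (d (n + 1)) j (Hom.app (d n) j z) = 0)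
    (d_exact : ∀ n j z, Hom.app (d (n + 1)) j z = 0 → ∃ y, Hom.app (d n) j y = z)
    (n : ℕ) {j : ℤ} {z : (K (n + 1)).X j} (hz : Hom.app (d (n + 1)) j z = 0)
    (hzL : ∀ x ∈ L, z ∈ ((K (n + 1)).powTorsion x.2).carrier j) :
    ∃ y, (∀ x ∈ L, y ∈ ((K n).powTorsion x.2).carrier j) ∧ Hom.app (d n) j y = z := by
  have ses : ∀ n, IsShortExact (ker (d n)).ι
      ((ker (d (n + 1))).lift (d n) (d_d n)) := fun n =>
    { inj := fun _ => Subtype.val_injective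
      zero := fun _ w => Subtype.ext w.2
      exact := fun _ w hw => ⟨⟨w, congrArg Subtype.val hw⟩, rfl⟩
      surj := fun _ w => by
        obtain ⟨y, hy⟩ := d_exact n _ w.1 w.2
        exact ⟨y, Subtype.ext hy⟩ }
  have flasque_ker : ∀ n, IsFlasque L (ker (d n)).obj := by
    intro n
    induction n with
    | zero =>
      refine isFlasque_of_subsingleton (fun j => ⟨fun a b => Subtype.ext (d_zero j ?_)⟩) L
      exact Eq.trans a.2 (Eq.symm b.2)
    | succ n ih => exact (ses n).isFlasque_right ih (hK n)
  obtain ⟨y, hy, hyz⟩ := (ses n).exists_lift_of_isFlasque (flasque_ker n) (z := ⟨z, hz⟩)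
    (fun x hx => mem_powTorsion_of_app (ker (d (n + 1))).ι (fun _ => Subtype.val_injective)
      (hzL x hx))
  exact ⟨y, hy, congrArg Subtype.val hyz⟩

end Flasque

end GrMod

/-! ### Injective graded modules over a Noetherian ring are flasque -/

namespace GrMod

theorem coind_apply_congr {k R : Type u} [Field k] [CommRing R] [Algebra k R]
    {𝒜 : ℕ → Submodule k R} {V : ℤ → Type u} [∀ n, AddCommGroup (V n)] [∀ n, Module k (V n)] {n : ℤ}
    (φ : ∀ q : {q : ℕ × ℤ // (q.1 : ℤ) + n = q.2}, (𝒜 q.1.1 →ₗ[k] V q.1.2)) {s t : ℕ}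
    (hst : s = t) {r : ℤ} (hs : (s : ℤ) + n = r) (ht : (t : ℤ) + n = r) {x : 𝒜 s} {y : 𝒜 t}
    (hxy : (x : R) = y) : φ ⟨(s, r), hs⟩ x = φ ⟨(t, r), ht⟩ y := by
  subst hst
  rw [Subtype.ext hxy]

section Baer

variable {k R : Type u} [Field k] [CommRing R] [Algebra k R]
  {𝒜 : ℕ → Submodule k R} [GradedAlgebra 𝒜]

/-- The homogeneous ideal with given homogeneous components. -/
def idealOfComponents (K : ∀ i, Submodule k (𝒜 i))
    (hK : ∀ {i j q : ℕ} (a : 𝒜 i) (u : 𝒜 j) (c : 𝒜 q), q = i + j → (c : R) = a * u → u ∈ K j →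
      c ∈ K q) : Ideal R where
  carrier := {r | ∀ i, DirectSum.decompose 𝒜 r i ∈ K i}
  zero_mem' i := by simp
  add_mem' hr hs i := by
    rw [DirectSum.decompose_add]
    exact add_mem (hr i) (hs i)
  smul_mem' c r hr n := by
    rw [smul_eq_mul]
    induction c using DirectSum.Decomposition.inductionOn 𝒜 with
    | zero => simp
    | add a b ha hb =>
      rw [add_mul, DirectSum.decompose_add]
      exact add_mem ha hb
    | homogeneous a =>
      rename_i i
      have := DirectSum.coe_decompose_mul_of_left_mem 𝒜 n (b := r) a.2
      split_ifs at this with hi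
      · exact hK a (DirectSum.decompose 𝒜 r (n - i)) _ (by omega) this (hr _)
      · rw [show DirectSum.decompose 𝒜 (a * r : R) n = 0 from Subtype.ext this]
        exact zero_mem _

theorem coe_mem_idealOfComponents (K : ∀ i, Submodule k (𝒜 i))
    (hK : ∀ {i j q : ℕ} (a : 𝒜 i) (u : 𝒜 j) (c : 𝒜 q), q = i + j → (c : R) = a * u → u ∈ K j →
      c ∈ K q) {i : ℕ} {u : 𝒜 i} : (u : R) ∈ idealOfComponents K hK ↔ u ∈ K i := by
  refine ⟨fun hu => ?_, fun hu j => ?_⟩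
  · have := hu i
    rwa [DirectSum.decompose_coe, DirectSum.of_eq_same] at this
  · rcases eq_or_ne i j with rfl | hij
    · rw [DirectSum.decompose_coe, DirectSum.of_eq_same]
      exact hu
    · rw [DirectSum.decompose_coe, DirectSum.of_eq_of_ne _ _ _ hij.symm]
      exact zero_mem _

/-- An increasing chain of homogeneous ideals, given by their components, stabilizes. -/
theorem exists_forall_component_le [IsNoetherianRing R] (K : ℕ → ∀ i, Submodule k (𝒜 i))
    (hK : ∀ m {i j q : ℕ} (a : 𝒜 i) (u : 𝒜 j) (c : 𝒜 q), q = i + j → (c : R) = a * u →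
      u ∈ K m j → c ∈ K m q)
    (mono : ∀ m i, K m i ≤ K (m + 1) i) :
    ∃ n, ∀ m, n ≤ m → ∀ i, K m i ≤ K n i := by
  obtain ⟨n, hn⟩ := monotone_stabilizes_iff_noetherian.2 (inferInstance : IsNoetherian R R)
    ⟨fun m => idealOfComponents (K m) (hK m),
      monotone_nat_of_le_succ fun m r hr i => mono m i (hr i)⟩
  refine ⟨n, fun m hm i u hu => ?_⟩
  have h : idealOfComponents (K n) (hK n) = idealOfComponents (K m) (hK m) := hn m hm
  rwa [← coe_mem_idealOfComponents (K n) (hK n), h, coe_mem_idealOfComponents]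

/-- The graded form of Baer's condition: every morphism `K(-d) → T` from a homogeneous ideal
extends to `R(-d)`, that is, it is multiplication by an element of degree `d`. The morphism is given
by its graph `G`. -/
def IsBaer (T : GrMod 𝒜) : Prop :=
  ∀ (d : ℤ) (G : ∀ i : ℕ, Submodule k (𝒜 i × T.X (i + d))),
    (∀ i t, ((0 : 𝒜 i), t) ∈ G i → t = 0) →
    (∀ {i j q : ℕ} (a : 𝒜 i) (u : 𝒜 j) (c : 𝒜 q) (t : T.X (j + d))
      (h : (i : ℤ) + (j + d) = q + d), (c : R) = a * u → (u, t) ∈ G j → (c, T.act h a t) ∈ G q) →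
    ∃ t₀ : T.X d, ∀ i u t, (u, t) ∈ G i → t = T.act rfl u t₀

/-- A linear map from a subspace, given by its graph, extends to the whole space. -/
theorem exists_linearMap_of_graph {U V : Type*} [AddCommGroup U] [Module k U] [AddCommGroup V]
    [Module k V] (G : Submodule k (U × V)) (hG : ∀ v, ((0 : U), v) ∈ G → v = 0) :
    ∃ f : U →ₗ[k] V, ∀ u v, (u, v) ∈ G → f u = v := by
  have hinj : LinearMap.ker (LinearMap.fst k U V ∘ₗ G.subtype) = ⊥ := by
    rw [LinearMap.ker_eq_bot']
    rintro ⟨⟨u, v⟩, h⟩ (rfl : u = 0)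
    obtain rfl := hG v h
    rfl
  obtain ⟨g, hg⟩ := LinearMap.exists_leftInverse_of_injective _ hinj
  refine ⟨LinearMap.snd k U V ∘ₗ G.subtype ∘ₗ g, fun u v h => ?_⟩
  have : g u = ⟨(u, v), h⟩ := LinearMap.congr_fun hg ⟨(u, v), h⟩
  simp [this]

/-- Morphisms to a coinduced module are families of linear maps, and linear maps extend from
subspaces. -/
theorem isBaer_coind (V : ℤ → Type u) [∀ n, AddCommGroup (V n)] [∀ n, Module k (V n)] :
    IsBaer (coind (𝒜 := 𝒜) V) := by
  intro d G hG hact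
  -- The value at `1`, in terms of a free index of `V` in order to avoid casts.
  let ev : ∀ (i : ℕ) (r : ℤ) (_ : (i : ℤ) + d = r), (coind (𝒜 := 𝒜) V).X (i + d) →ₗ[k] V r :=
    fun i r h => LinearMap.applyₗ (⟨1, SetLike.GradedOne.one_mem⟩ : 𝒜 0) ∘ₗ
      LinearMap.proj (⟨(0, r), by simpa using h⟩ :
        {q : ℕ × ℤ // (q.1 : ℤ) + (i + d) = q.2})
  have key : ∀ (i j : ℕ) (r : ℤ) (u : 𝒜 i) (t : (coind (𝒜 := 𝒜) V).X (i + d)) (b : 𝒜 j)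
      (c : 𝒜 (j + i)) (h : (j : ℤ) + (i + d) = r) (h' : ((j + i : ℕ) : ℤ) + d = r),
      (c : R) = b * u → (u, t) ∈ G i →
      ∃ t', (c, t') ∈ G (j + i) ∧ ev (j + i) r h' t'
        = (show ∀ q : {q : ℕ × ℤ // (q.1 : ℤ) + (i + d) = q.2}, (𝒜 q.1.1 →ₗ[k] V q.1.2) from t)
            ⟨(j, r), h⟩ b := by
    intro i j r u t b c h h' hc hut
    refine ⟨_, hact b u c t (by push_cast; ring) hc hut, ?_⟩
    exact coind_apply_congr (𝒜 := 𝒜) _ (zero_add j) _ _ (one_mul _)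
  have ext : ∀ q : {q : ℕ × ℤ // (q.1 : ℤ) + d = q.2}, ∃ f : 𝒜 q.1.1 →ₗ[k] V q.1.2,
      ∀ u t, (u, t) ∈ G q.1.1 → f u = ev q.1.1 q.1.2 q.2 t := by
    rintro ⟨⟨q, r⟩, hq⟩
    obtain ⟨f, hf⟩ := exists_linearMap_of_graph ((G q).map (LinearMap.id.prodMap (ev q r hq))) (by
      rintro v ⟨⟨u, t⟩, hut, h⟩
      obtain ⟨rfl, rfl⟩ := Prod.mk.inj h
      obtain rfl := hG q t hut
      exact map_zero _)
    exact ⟨f, fun u t hut => hf u _ ⟨(u, t), hut, rfl⟩⟩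
  choose f hf using ext
  refine ⟨f, fun i u t hut => ?_⟩
  funext ⟨⟨j, r⟩, hj⟩
  refine LinearMap.ext fun b => ?_
  obtain ⟨t', ht', h⟩ := key i j r u t b ⟨b * u, SetLike.GradedMul.mul_mem b.2 u.2⟩ hj
    (by have : (j : ℤ) + (i + d) = r := hj
        push_cast; omega) rfl hut
  exact h.symm.trans (hf ⟨(j + i, r), _⟩ _ _ ht').symm

theorem IsBaer.of_retract {T C : GrMod 𝒜} (hC : IsBaer C) (f : T ⟶ C) (r : C ⟶ T)
    (hfr : f ≫ r = 𝟙 T) : IsBaer T := by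
  have hrf : ∀ n t, Hom.app r n (Hom.app f n t) = t := fun n t =>
    congrArg (fun g : T ⟶ T => Hom.app g n t) hfr
  intro d G hG hact
  obtain ⟨c, hc⟩ := hC d (fun i => (G i).map (LinearMap.id.prodMap (Hom.app f _))) (by
      rintro i v ⟨⟨u, t⟩, hut, h⟩
      obtain ⟨rfl, rfl⟩ := Prod.mk.inj h
      obtain rfl := hG i t hut
      exact map_zero _) (by
      rintro i j q a u c v h hc ⟨⟨u', t⟩, hut, h'⟩
      obtain ⟨rfl, rfl⟩ := Prod.mk.inj h'
      exact ⟨_, hact a _ c t h hc hut, Prod.ext rfl (f.comm h a t)⟩)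
  refine ⟨Hom.app r d c, fun i u t hut => ?_⟩
  rw [← r.comm, ← hc i u _ ⟨_, hut, rfl⟩]
  exact (hrf _ t).symm

/-- An injective module is a retract of a coinduced module. -/
theorem isBaer_of_injective (T : GrMod 𝒜) [Injective T] : IsBaer T := by
  let f : T ⟶ coind T.X := coindLift T.X (fun _ => LinearMap.id)
  have : Mono f := mono_of_injective _ (fun n x y hxy => by
    have := congrArg (coindEv T.X n) hxy
    rwa [coindEv_lift, coindEv_lift] at this)
  exact (isBaer_coind T.X).of_retract f (Injective.factorThru (𝟙 T) f)
    (Injective.comp_factorThru _ _)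

/-- A homogeneous multiple of a homogeneous element is a multiple by a homogeneous element. -/
theorem exists_homogeneous_factor {n i : ℕ} {x v : R} (hx : x ∈ 𝒜 n) (hv : v ∈ 𝒜 i)
    (h : v ∈ Ideal.span {x}) : v = 0 ∨ ∃ j, n + j = i ∧ ∃ u ∈ 𝒜 j, v = x * u := by
  obtain ⟨r, rfl⟩ := Ideal.mem_span_singleton'.1 h
  rw [mul_comm r x] at *
  have h₁ := DirectSum.coe_decompose_mul_of_left_mem 𝒜 i (b := r) hx
  rw [DirectSum.decompose_of_mem_same 𝒜 hv] at h₁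
  split_ifs at h₁ with hi
  · exact Or.inr ⟨i - n, by omega, _, (DirectSum.decompose 𝒜 r (i - n)).2, h₁⟩
  · exact Or.inl h₁

/-- To divide `m` by `x ^ e` modulo torsion, extend the morphism `x ^ (N + e) r ↦ r x ^ N m` from
the ideal `(x ^ (N + e))` to `R`. It is well defined if `N` is large, since then
`x ^ (N + e) r = 0` implies `x ^ N r = 0`. -/
theorem IsBaer.isDivisible [IsNoetherianRing R] {T : GrMod 𝒜} (hT : IsBaer T) {n : ℕ} (x : 𝒜 n) :
    T.IsDivisible x := by
  intro e d l h m
  -- The annihilator of `x ^ N` does not depend on the large exponent `N`.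
  obtain ⟨N, hN⟩ := exists_forall_component_le (𝒜 := 𝒜)
    (fun m i => LinearMap.ker (LinearMap.mulLeft k ((x : R) ^ m) ∘ₗ (𝒜 i).subtype))
    (by
      intro m i j q a u c _ hc hu
      have hu : (x : R) ^ m * u = 0 := hu
      change (x : R) ^ m * c = 0
      rw [hc, mul_left_comm, hu, mul_zero])
    (by
      intro m i u hu
      have hu : (x : R) ^ m * u = 0 := hu
      change (x : R) ^ (m + 1) * u = 0
      rw [pow_succ', mul_assoc, hu, mul_zero])
  -- The graph of `x ^ (N + e) r ↦ r x ^ N m`.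
  let G : ∀ i : ℕ, Submodule k (𝒜 i × T.X (i + d)) := fun i =>
    { carrier := {p | p = 0 ∨ ∃ (j : ℕ) (hj : (N + e) * n + j = i) (r : 𝒜 j),
        (p.1 : R) = (x : R) ^ (N + e) * r ∧
        p.2 = T.act (l := i + d) (by rw [← hj, ← h]; push_cast; ring) r (T.powAct x N rfl m)}
      zero_mem' := Or.inl rfl
      add_mem' := by
        rintro p p' (rfl | ⟨j, hj, r, h₁, h₂⟩) hp'
        · rwa [zero_add]
        · rcases hp' with rfl | ⟨j', hj', r', h₁', h₂'⟩
          · have hp : p + 0 = p := add_zero p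
            exact Or.inr ⟨j, hj, r, by rw [hp]; exact h₁, by rw [hp]; exact h₂⟩
          · obtain rfl : j = j' := by omega
            refine Or.inr ⟨j, hj, r + r', ?_, ?_⟩
            · simp [h₁, h₁', mul_add]
            · simp [h₂, h₂']
      smul_mem' := by
        rintro c p (rfl | ⟨j, hj, r, h₁, h₂⟩)
        · rw [smul_zero]
          exact Or.inl rfl
        · refine Or.inr ⟨j, hj, c • r, ?_, ?_⟩
          · simp [h₁]
          · simp [h₂] }
  obtain ⟨t, ht⟩ := hT d G (by
      rintro i t (h0 | ⟨j, hj, r, h₁, h₂⟩)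
      · exact congrArg Prod.snd h0
      · have hr : (x : R) ^ N * r = 0 := hN (N + e) (Nat.le_add_right _ _) j h₁.symm
        change t = _ at h₂
        rw [h₂, powAct, T.act_act (q := j + N * n) (c := 0) rfl (by
            change (0 : R) = r * (x : R) ^ N
            rw [mul_comm, hr]) _ _ (by rw [← h] at *; push_cast; subst hj; push_cast; ring),
          map_zero, LinearMap.zero_apply]) (by
      rintro i j q a u c t h' hc (h0 | ⟨s, hs, r, h₁, h₂⟩)
      · obtain ⟨rfl, rfl⟩ := Prod.mk.inj h0
        refine Or.inl (Prod.ext (Subtype.ext (hc.trans (mul_zero _))) (map_zero _))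
      · refine Or.inr ⟨i + s, by omega, ⟨a * r, SetLike.GradedMul.mul_mem a.2 r.2⟩, ?_, ?_⟩
        · change (c : R) = x ^ (N + e) * (a * r)
          change (u : R) = x ^ (N + e) * r at h₁
          rw [hc, h₁, mul_left_comm]
        · change t = _ at h₂
          rw [h₂]
          exact T.act_act rfl rfl _ _ _ _)
  refine ⟨t, mem_powTorsion_of_eq_zero (e := N) rfl ?_⟩
  have hx := ht ((N + e) * n) (homPow x (N + e))
    (T.act (i := 0) (by rw [← h]; push_cast; ring) ⟨1, SetLike.GradedOne.one_mem⟩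
      (T.powAct x N rfl m))
    (Or.inr ⟨0, rfl, ⟨1, SetLike.GradedOne.one_mem⟩, (mul_one _).symm, rfl⟩)
  rw [map_sub, T.powAct_powAct x rfl h rfl (by rw [← h]; push_cast; ring), sub_eq_zero]
  have hdeg : (((N + e) * n : ℕ) : ℤ) + d = ((N * n : ℕ) : ℤ) + l := by
    rw [← h]; push_cast; ring
  have gen : ∀ (p p' : ℤ) (hp : p = p') (h₁ : ((0 : ℕ) : ℤ) + p' = p)
      (h₂ : (((N + e) * n : ℕ) : ℤ) + d = p) (h₂' : (((N + e) * n : ℕ) : ℤ) + d = p')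
      (y : T.X p'),
      T.act h₁ ⟨1, SetLike.GradedOne.one_mem⟩ y = T.act h₂ (homPow x (N + e)) t →
      T.powAct x (N + e) h₂' t = y := by
    rintro p _ rfl h₁ h₂ h₂' y hy
    rw [T.one_act] at hy
    exact hy.symm
  exact gen _ _ hdeg _ _ _ _ hx

/-- The `x`-power torsion of a module satisfying Baer's condition satisfies Baer's condition. A
morphism `φ` from a homogeneous ideal `K` to the torsion is killed by a power of `x`, so by the
Artin–Rees property of powers of `x` it vanishes on `K ∩ (x ^ N)` for large `N`. Extending `φ` by
zero to `K + (x ^ N)` makes it multiplication by an element killed by `x ^ N`. -/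
theorem IsBaer.powTorsion [IsNoetherianRing R] {T : GrMod 𝒜} (hT : IsBaer T) {n : ℕ} (x : 𝒜 n) :
    IsBaer (T.powTorsion x).obj := by
  intro d G hG hact
  have hG' : ∀ {i} {u : 𝒜 i} {t t'}, (u, t) ∈ G i → (u, t') ∈ G i → t = t' := by
    intro i u t t' h h'
    refine sub_eq_zero.1 (hG i _ ?_)
    have := sub_mem h h'
    rwa [Prod.mk_sub_mk, sub_self] at this
  -- The elements of the source killed by `x ^ m` after applying the morphism form an increasing
  -- chain of ideals, so a single power `x ^ N₁` kills the image.
  obtain ⟨N₁, hN₁⟩ := exists_forall_component_le (𝒜 := 𝒜)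
    (fun m i => ((G i) ⊓ (LinearMap.ker ((T.powTorsion x).obj.powAct x m
      (l := ((m * n : ℕ) : ℤ) + (i + d)) rfl ∘ₗ LinearMap.snd k _ _))).map (LinearMap.fst k _ _))
    (by
      rintro m i j q a u c hq hc ⟨⟨_, t⟩, ⟨hut, ht⟩, rfl⟩
      refine ⟨_, ⟨hact a _ c t (by rw [hq]; push_cast; ring) hc hut, ?_⟩, rfl⟩
      change (T.powTorsion x).obj.powAct x m rfl t = 0 at ht
      change (T.powTorsion x).obj.powAct x m rfl (GrMod.act _ _ a t) = 0
      rw [powAct_act _ x m a _ _ rfl (by rw [hq]; push_cast; ring), ht, map_zero])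
    (by
      rintro m i _ ⟨⟨u, t⟩, ⟨hut, ht⟩, rfl⟩
      refine ⟨_, ⟨hut, ?_⟩, rfl⟩
      change (T.powTorsion x).obj.powAct x (m + 1) rfl t = 0
      refine powAct_eq_zero_of_le _ x (Nat.le_succ m) ?_ _ _
      rintro _ rfl
      exact ht)
  have hkill : ∀ {i} {u : 𝒜 i} {t}, (u, t) ∈ G i →
      ∀ l h, (T.powTorsion x).obj.powAct x N₁ (l := l) h t = 0 := by
    intro i u t hut l h
    obtain ⟨e, he⟩ := t.2
    have : u ∈ _ := hN₁ (max N₁ e) (le_max_left _ _) i ⟨(u, t), ⟨hut, by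
      change (T.powTorsion x).obj.powAct x (max N₁ e) rfl t = 0
      refine powAct_eq_zero_of_le _ x (le_max_right N₁ e) ?_ _ _
      exact fun l h => Subtype.ext (he l h)⟩, rfl⟩
    obtain ⟨⟨_, t'⟩, ⟨hut', ht'⟩, rfl⟩ := this
    obtain rfl := hG' hut hut'
    subst h
    exact ht'
  -- The ideals `K : x ^ m` do not depend on `m` for `m ≥ N₂`, where `K` is the source.
  obtain ⟨N₂, hN₂⟩ := exists_forall_component_le (𝒜 := 𝒜)
    (fun m i => ((G (m * n + i)).map (LinearMap.fst k _ _)).comap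
      (DirectSum.gMulLHom k (fun i => 𝒜 i) (homPow x m)))
    (by
      rintro m i j q a u c hq hc ⟨⟨_, t⟩, hut, rfl⟩
      refine ⟨_, hact a _ ⟨x ^ m * c, SetLike.GradedMul.mul_mem (homPow x m).2 c.2⟩ t
        (by rw [hq]; push_cast; ring) ?_ hut, rfl⟩
      change (x : R) ^ m * (c : R) = a * (x ^ m * u)
      rw [hc, mul_left_comm])
    (by
      rintro m i u ⟨⟨_, t⟩, hut, rfl⟩
      refine ⟨_, hact x _ ⟨x ^ (m + 1) * u, SetLike.GradedMul.mul_mem (homPow x (m + 1)).2 u.2⟩ t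
        (by push_cast; ring) ?_ hut, rfl⟩
      change (x : R) ^ (m + 1) * (u : R) = x * (x ^ m * u)
      rw [pow_succ', mul_assoc])
  have hzero : ∀ {i j} (_ : (N₁ + N₂) * n + j = i) {u : 𝒜 i} {v : 𝒜 j} {t},
      (u : R) = x ^ (N₁ + N₂) * v → (u, t) ∈ G i → t = 0 := by
    rintro _ j rfl u v t huv hut
    obtain ⟨⟨u', t'⟩, hut', hu'⟩ : v ∈ _ := hN₂ (N₁ + N₂) (Nat.le_add_left _ _) j
      ⟨(u, t), hut, Subtype.ext huv⟩
    have hu' : (u' : R) = x ^ N₂ * v := congrArg Subtype.val hu'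
    refine hG' hut ?_
    have h := hact (homPow x N₁) u' u t' (by push_cast; ring)
      (huv.trans (by rw [hu', pow_add, mul_assoc]; rfl)) hut'
    rwa [show GrMod.act _ _ (homPow x N₁) t' = 0 from hkill hut' _ _] at h
  -- The graph of the extension by zero to `K + (x ^ (N₁ + N₂))`.
  obtain ⟨t₀, ht₀⟩ := hT d (fun i =>
      (G i).map (LinearMap.id.prodMap ((T.powTorsion x).carrier _).subtype) ⊔
        (((Ideal.span {(x : R) ^ (N₁ + N₂)}).restrictScalars k).comap (𝒜 i).subtype).map
          (LinearMap.inl k _ _))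
    (by
      intro i t ht
      obtain ⟨_, ⟨⟨u, t'⟩, hut, rfl⟩, _, ⟨v, hv, rfl⟩, h⟩ := Submodule.mem_sup.1 ht
      obtain ⟨h₁, h₂⟩ := Prod.mk.inj h
      have h₁ : u = -v := eq_neg_of_add_eq_zero_left h₁
      obtain rfl : t'.1 = t := by simpa using h₂
      have hv : (v : R) ∈ Ideal.span {(x : R) ^ (N₁ + N₂)} := hv
      suffices t' = 0 by rw [this]; rfl
      rcases exists_homogeneous_factor (homPow x (N₁ + N₂)).2 v.2 hv with hv | ⟨j, hj, w, hw, hv⟩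
      · obtain rfl : u = 0 := by rw [h₁, Subtype.ext (a2 := (0 : 𝒜 i)) hv, neg_zero]
        exact hG i t' hut
      · refine hzero hj (v := -⟨w, hw⟩) ?_ hut
        rw [h₁]
        change -(v : R) = x ^ (N₁ + N₂) * -w
        rw [hv, mul_neg]
        rfl)
    (by
      intro i j q a u c t h hc ht
      obtain rfl : q = i + j := by
        have : (q : ℤ) = i + j := by linarith
        exact_mod_cast this
      obtain ⟨_, ⟨⟨u', t'⟩, hut, rfl⟩, _, ⟨v, hv, rfl⟩, h'⟩ := Submodule.mem_sup.1 ht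
      obtain ⟨rfl, h₂⟩ := Prod.mk.inj h'
      obtain rfl : t'.1 = t := by simpa using h₂
      refine Submodule.mem_sup.2 ⟨_, ⟨_, hact a u'
        ⟨a * u', SetLike.GradedMul.mul_mem a.2 u'.2⟩ t' h rfl hut, rfl⟩, _,
        ⟨⟨a * v, SetLike.GradedMul.mul_mem a.2 v.2⟩,
          (Ideal.span {(x : R) ^ (N₁ + N₂)}).mul_mem_left (a : R) hv, rfl⟩, ?_⟩
      refine Prod.ext (Subtype.ext ?_) (add_zero _)
      rw [hc]
      exact (mul_add (a : R) u' v).symm)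
  refine ⟨⟨t₀, mem_powTorsion_of_eq_zero (e := N₁ + N₂) rfl ?_⟩, fun i u t hut => Subtype.ext ?_⟩
  · exact (ht₀ _ (homPow x (N₁ + N₂)) 0
      (Submodule.mem_sup_right ⟨_, Ideal.mem_span_singleton_self _, rfl⟩)).symm
  · exact ht₀ i u t.1 (Submodule.mem_sup_left ⟨_, hut, rfl⟩)

theorem IsBaer.isFlasque [IsNoetherianRing R] {T : GrMod 𝒜} (hT : IsBaer T)
    (L : List (Σ n, 𝒜 n)) : IsFlasque L T := by
  induction L generalizing T with
  | nil => trivial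
  | cons x L ih => exact ⟨hT.isDivisible x.2, ih (hT.powTorsion x.2)⟩

end Baer

end GrMod

/-! ### Segre products of flasque modules are flasque -/

section Segre

variable {k R S : Type u} [Field k] [CommRing R] [Algebra k R] [CommRing S] [Algebra k S]
  {𝒜 : ℕ → Submodule k R} {ℬ : ℕ → Submodule k S} [GradedAlgebra 𝒜] [GradedAlgebra ℬ]

/-- The element `a ⊗ b` of the degree `n` part of `R # S`. -/
def segreTmul {n : ℕ} (a : 𝒜 n) (b : ℬ n) : segreGrading 𝒜 ℬ n :=
  segreOf 𝒜 ℬ n (a ⊗ₜ[k] b)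

/-- Over a field, `(A' ⊗ B) ∩ (A ⊗ B') = A' ⊗ B'` in `A ⊗ B`. -/
theorem TensorProduct.exists_of_rTensor_eq_lTensor {A B : Type u} [AddCommGroup A] [Module k A]
    [AddCommGroup B] [Module k B] (A' : Submodule k A) (B' : Submodule k B) {u : A' ⊗[k] B}
    {v : A ⊗[k] B'} (h : A'.subtype.rTensor B u = B'.subtype.lTensor A v) :
    ∃ w : A' ⊗[k] B', B'.subtype.lTensor A' w = u ∧ A'.subtype.rTensor B' w = v := by
  have hB : Function.Exact B'.subtype B'.mkQ := LinearMap.exact_subtype_mkQ B'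
  have hu : B'.mkQ.lTensor A' u = 0 := by
    refine Module.Flat.rTensor_preserves_injective_linearMap (M := B ⧸ B') A'.subtype
      A'.injective_subtype ?_
    rw [map_zero, ← LinearMap.comp_apply, LinearMap.rTensor_comp_lTensor,
      ← LinearMap.lTensor_comp_rTensor, LinearMap.comp_apply, h]
    exact (lTensor_exact A hB (Submodule.mkQ_surjective _)).apply_apply_eq_zero v
  obtain ⟨w, rfl⟩ := (lTensor_exact A' hB (Submodule.mkQ_surjective _) u).1 hu
  refine ⟨w, rfl, ?_⟩
  refine Module.Flat.lTensor_preserves_injective_linearMap (M := A) B'.subtype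
    B'.injective_subtype ?_
  rw [← h, ← LinearMap.comp_apply, LinearMap.lTensor_comp_rTensor,
      ← LinearMap.rTensor_comp_lTensor, LinearMap.comp_apply]

/-- Over a field, the kernel of `f ⊗ g` is `ker f ⊗ B + A ⊗ ker g`. -/
theorem TensorProduct.exists_of_map_eq_zero {A B C D : Type u} [AddCommGroup A] [Module k A]
    [AddCommGroup B] [Module k B] [AddCommGroup C] [Module k C] [AddCommGroup D] [Module k D]
    (f : A →ₗ[k] C) (g : B →ₗ[k] D) {z : A ⊗[k] B} (hz : TensorProduct.map f g z = 0) :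
    ∃ (u : LinearMap.ker f ⊗[k] B) (v : A ⊗[k] LinearMap.ker g),
      (LinearMap.ker f).subtype.rTensor B u + (LinearMap.ker g).subtype.lTensor A v = z := by
  have hz' : z ∈ LinearMap.ker (TensorProduct.map f.rangeRestrict g.rangeRestrict) := by
    refine TensorProduct.map_injective_of_flat_flat (LinearMap.range f).subtype
      (LinearMap.range g).subtype (Submodule.injective_subtype _) (Submodule.injective_subtype _) ?_
    rw [map_zero, ← LinearMap.comp_apply, ← TensorProduct.map_comp]
    exact hz
  have hexact : ∀ {A C : Type u} [AddCommGroup A] [Module k A] [AddCommGroup C] [Module k C]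
      (f : A →ₗ[k] C), Function.Exact (LinearMap.ker f).subtype f.rangeRestrict := by
    intro A C _ _ _ _ f y
    rw [← LinearMap.mem_ker, LinearMap.ker_rangeRestrict]
    exact ⟨fun hy => ⟨⟨y, hy⟩, rfl⟩, by rintro ⟨y, rfl⟩; exact y.2⟩
  rw [TensorProduct.map_ker (hexact f) f.surjective_rangeRestrict (hexact g)
    g.surjective_rangeRestrict] at hz'
  obtain ⟨_, ⟨v, rfl⟩, _, ⟨u, rfl⟩, rfl⟩ := Submodule.mem_sup.1 hz'
  exact ⟨u, v, add_comm _ _⟩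

namespace GrMod

theorem powAct_succ {k R : Type u} [Field k] [CommRing R] [Algebra k R]
    {𝒜 : ℕ → Submodule k R} [GradedAlgebra 𝒜] (M : GrMod 𝒜) {n : ℕ} (x : 𝒜 n) (e : ℕ)
    {j l p : ℤ} (h : (n : ℤ) + j = l) (h' : ((e * n : ℕ) : ℤ) + l = p)
    (h'' : (((e + 1) * n : ℕ) : ℤ) + j = p) (m : M.X j) :
    M.powAct x (e + 1) h'' m = M.powAct x e h' (M.act h x m) := by
  rw [← M.powAct_one x (by rw [one_mul]; exact h) h, M.powAct_powAct x rfl]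

theorem act_segreTmul (M : GrMod 𝒜) (N : GrMod ℬ) {n : ℕ} (a : 𝒜 n) (b : ℬ n) {j l : ℤ}
    (h : (n : ℤ) + j = l) :
    (segreObj M N).act h (segreTmul a b) = TensorProduct.map (M.act h a) (N.act h b) := by
  refine LinearMap.ext fun z => ?_
  have hab : segreComponent 𝒜 ℬ n (segreOf 𝒜 ℬ n (a ⊗ₜ[k] b)) = a ⊗ₜ[k] b :=
    DirectSum.of_eq_same n _
  exact congrArg (fun t => segreAct M N h t z) hab

theorem powAct_segreTmul (M : GrMod 𝒜) (N : GrMod ℬ) {n : ℕ} (a : 𝒜 n) (b : ℬ n) (e : ℕ) {j l : ℤ}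
    (h : ((e * n : ℕ) : ℤ) + j = l) :
    (segreObj M N).powAct (segreTmul a b) e h
      = TensorProduct.map (M.powAct a e h) (N.powAct b e h) := by
  induction e generalizing j with
  | zero =>
    obtain rfl : j = l := by simpa using h
    exact TensorProduct.ext' fun m m' => (powAct_zero (segreObj M N) (segreTmul a b) h
        (m ⊗ₜ[k] m')).trans
      (congrArg₂ (fun u v => u ⊗ₜ[k] v) (powAct_zero M a h m).symm (powAct_zero N b h m').symm)
  | succ e ih =>
    have h' : ((e * n : ℕ) : ℤ) + ((n : ℤ) + j) = l := by rw [← h]; push_cast; ring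
    refine TensorProduct.ext' fun m m' => ?_
    have h₁ := LinearMap.congr_fun (act_segreTmul M N a b (j := j) rfl) (m ⊗ₜ[k] m')
    exact (powAct_succ (segreObj M N) (segreTmul a b) e rfl h' h (m ⊗ₜ[k] m')).trans <|
      (congrArg _ h₁).trans <|
      (LinearMap.congr_fun (ih h') _).trans <|
        congrArg₂ (fun u v => u ⊗ₜ[k] v) (powAct_succ M a e rfl h' h m).symm
          (powAct_succ N b e rfl h' h m').symm

theorem rTensor_mem_powTorsion {M : GrMod 𝒜} {N : GrMod ℬ} {n : ℕ} (a : 𝒜 n) (b : ℬ n) {j : ℤ}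
    (z : (M.powTorsion a).carrier j ⊗[k] N.X j) :
    ((M.powTorsion a).carrier j).subtype.rTensor (N.X j) z ∈
      ((segreObj M N).powTorsion (segreTmul a b)).carrier j := by
  induction z using TensorProduct.induction_on with
  | zero => rw [map_zero]; exact zero_mem _
  | add z w hz hw => rw [map_add]; exact add_mem hz hw
  | tmul u v =>
    obtain ⟨u, e, he⟩ := u
    refine ⟨e, fun l h => ?_⟩
    rw [powAct_segreTmul]
    change M.powAct a e h u ⊗ₜ[k] N.powAct b e h v = 0
    rw [he, TensorProduct.zero_tmul]

theorem lTensor_mem_powTorsion {M : GrMod 𝒜} {N : GrMod ℬ} {n : ℕ} (a : 𝒜 n) (b : ℬ n) {j : ℤ}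
    (z : M.X j ⊗[k] (N.powTorsion b).carrier j) :
    ((N.powTorsion b).carrier j).subtype.lTensor (M.X j) z ∈
      ((segreObj M N).powTorsion (segreTmul a b)).carrier j := by
  induction z using TensorProduct.induction_on with
  | zero => rw [map_zero]; exact zero_mem _
  | add z w hz hw => rw [map_add]; exact add_mem hz hw
  | tmul u v =>
    obtain ⟨v, e, he⟩ := v
    refine ⟨e, fun l h => ?_⟩
    rw [powAct_segreTmul]
    change M.powAct a e h u ⊗ₜ[k] N.powAct b e h v = 0
    rw [he, TensorProduct.tmul_zero]

/-- Modulo torsion, `u ⊗ v` is divisible by `a ⊗ b`, as `u` is by `a` and `v` is by `b`. -/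
theorem isDivisible_segreObj {M : GrMod 𝒜} {N : GrMod ℬ} {n : ℕ} {a : 𝒜 n} {b : ℬ n}
    (hM : M.IsDivisible a) (hN : N.IsDivisible b) :
    (segreObj M N).IsDivisible (segreTmul a b) := by
  intro e j l h z
  rw [powAct_segreTmul]
  let P : Submodule k (M.X l ⊗[k] N.X l) :=
    ((segreObj M N).powTorsion (segreTmul a b)).carrier l
  have key : ∀ z : M.X l ⊗[k] N.X l, ∃ z' : M.X j ⊗[k] N.X j,
      TensorProduct.map (M.powAct a e h) (N.powAct b e h) z' - z ∈ P := by
    intro z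
    induction z using TensorProduct.induction_on with
    | zero => exact ⟨0, by rw [map_zero, sub_zero]; exact zero_mem _⟩
    | add z w hz hw =>
      obtain ⟨z', hz'⟩ := hz
      obtain ⟨w', hw'⟩ := hw
      refine ⟨z' + w', ?_⟩
      rw [map_add, add_sub_add_comm]
      exact add_mem hz' hw'
    | tmul u v =>
      obtain ⟨u', hu'⟩ := hM e h u
      obtain ⟨v', hv'⟩ := hN e h v
      refine ⟨u' ⊗ₜ[k] v', ?_⟩
      have h₁ : M.powAct a e h u' ⊗ₜ[k] N.powAct b e h v' - u ⊗ₜ[k] v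
          = (M.powAct a e h u' - u) ⊗ₜ[k] N.powAct b e h v'
            + u ⊗ₜ[k] (N.powAct b e h v' - v) := by
        rw [TensorProduct.sub_tmul, TensorProduct.tmul_sub, sub_add_sub_cancel]
      rw [TensorProduct.map_tmul, h₁]
      exact add_mem (rTensor_mem_powTorsion a b (⟨_, hu'⟩ ⊗ₜ[k] _))
        (lTensor_mem_powTorsion a b (_ ⊗ₜ[k] ⟨_, hv'⟩))
  exact key z

/-- The morphism `Γ_a(M) # Γ_b(N) → (Γ_a(M) # N) ⊕ (M # Γ_b(N))`. -/
noncomputable def segreTorsionDiag (M : GrMod 𝒜) (N : GrMod ℬ) {n : ℕ} (a : 𝒜 n) (b : ℬ n) :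
    segreObj (M.powTorsion a).obj (N.powTorsion b).obj ⟶
      prod (segreObj (M.powTorsion a).obj N) (segreObj M (N.powTorsion b).obj) :=
  segreMap (𝟙 _) (N.powTorsion b).ι ≫ (bicone _ _).inl +
    segreMap (M.powTorsion a).ι (𝟙 _) ≫ (bicone _ _).inr

/-- The morphism `(Γ_a(M) # N) ⊕ (M # Γ_b(N)) → Γ_{a ⊗ b}(M # N)`, `(u, v) ↦ u - v`. -/
noncomputable def segreTorsionDiff (M : GrMod 𝒜) (N : GrMod ℬ) {n : ℕ} (a : 𝒜 n) (b : ℬ n) :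
    prod (segreObj (M.powTorsion a).obj N) (segreObj M (N.powTorsion b).obj) ⟶
      ((segreObj M N).powTorsion (segreTmul a b)).obj :=
  (bicone _ _).fst ≫ Sub.lift _ (segreMap (M.powTorsion a).ι (𝟙 N))
      (fun _ z => rTensor_mem_powTorsion a b z) +
    -((bicone _ _).snd ≫ Sub.lift _ (segreMap (𝟙 M) (N.powTorsion b).ι)
      (fun _ z => lTensor_mem_powTorsion a b z))

/-- Over a field, `Γ_{a ⊗ b}(M # N) = Γ_a(M) # N + M # Γ_b(N)`, and the intersection of the two
summands is `Γ_a(M) # Γ_b(N)`. -/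
theorem isShortExact_segreTorsion (M : GrMod 𝒜) (N : GrMod ℬ) {n : ℕ} (a : 𝒜 n) (b : ℬ n) :
    IsShortExact (segreTorsionDiag M N a b) (segreTorsionDiff M N a b) where
  inj j z w h := by
    have h₁ : ((N.powTorsion b).carrier j).subtype.lTensor ((M.powTorsion a).carrier j) z + 0
        = ((N.powTorsion b).carrier j).subtype.lTensor ((M.powTorsion a).carrier j) w + 0 :=
      congrArg Prod.fst h
    rw [add_zero, add_zero] at h₁
    exact Module.Flat.lTensor_preserves_injective_linearMap _ (Submodule.injective_subtype _) h₁
  zero := fun j (z : (M.powTorsion a).carrier j ⊗[k] (N.powTorsion b).carrier j) => by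
    refine Subtype.ext ?_
    change ((M.powTorsion a).carrier j).subtype.rTensor (N.X j)
        (((N.powTorsion b).carrier j).subtype.lTensor ((M.powTorsion a).carrier j) z + 0)
      + -(((N.powTorsion b).carrier j).subtype.lTensor (M.X j)
        (0 + ((M.powTorsion a).carrier j).subtype.rTensor ((N.powTorsion b).carrier j) z)) = 0
    rw [add_zero, zero_add, ← LinearMap.comp_apply, ← LinearMap.comp_apply,
      LinearMap.rTensor_comp_lTensor, LinearMap.lTensor_comp_rTensor, add_neg_cancel]
  exact j z h := by
    obtain ⟨u, v⟩ := z
    have h₁ : ((M.powTorsion a).carrier j).subtype.rTensor (N.X j) u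
        + -(((N.powTorsion b).carrier j).subtype.lTensor (M.X j) v) = 0 := congrArg Subtype.val h
    rw [← sub_eq_add_neg, sub_eq_zero] at h₁
    obtain ⟨w, hu, hv⟩ := TensorProduct.exists_of_rTensor_eq_lTensor _ _ h₁
    exact ⟨w, Prod.ext ((add_zero _).trans hu) ((zero_add _).trans hv)⟩
  surj j := by
    rintro ⟨z, e, he⟩
    have hz := he _ rfl
    rw [powAct_segreTmul] at hz
    obtain ⟨u, v, rfl⟩ := TensorProduct.exists_of_map_eq_zero _ _ hz
    have hu : LinearMap.ker (M.powAct a e rfl) ≤ (M.powTorsion a).carrier j :=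
      fun _ hm => mem_powTorsion_of_eq_zero rfl hm
    have hv : LinearMap.ker (N.powAct b e rfl) ≤ (N.powTorsion b).carrier j :=
      fun _ hm => mem_powTorsion_of_eq_zero rfl hm
    refine ⟨((Submodule.inclusion hu).rTensor _ u, -((Submodule.inclusion hv).lTensor _ v)),
      Subtype.ext ?_⟩
    change ((M.powTorsion a).carrier j).subtype.rTensor (N.X j)
        ((Submodule.inclusion hu).rTensor _ u)
      + -(((N.powTorsion b).carrier j).subtype.lTensor (M.X j)
        (-((Submodule.inclusion hv).lTensor _ v))) = _
    rw [map_neg, neg_neg, ← LinearMap.comp_apply, ← LinearMap.comp_apply, ← LinearMap.rTensor_comp,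
      ← LinearMap.lTensor_comp]
    rfl

/-- The Segre product of two modules that are flasque along all lists of homogeneous elements is
flasque along all lists of elements `a ⊗ b`. -/
theorem isFlasque_segreObj {M : GrMod 𝒜} {N : GrMod ℬ} (hM : ∀ L, IsFlasque L M)
    (hN : ∀ L, IsFlasque L N) (L : List (Σ n, 𝒜 n × ℬ n)) :
    IsFlasque (L.map fun x => ⟨x.1, segreTmul x.2.1 x.2.2⟩) (segreObj M N) := by
  induction L generalizing M N with
  | nil => trivial
  | cons x L ih =>
    obtain ⟨n, a, b⟩ := x
    have hM' : ∀ L, IsFlasque L (M.powTorsion a).obj := fun L => (hM (⟨n, a⟩ :: L)).2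
    have hN' : ∀ L, IsFlasque L (N.powTorsion b).obj := fun L => (hN (⟨n, b⟩ :: L)).2
    exact ⟨isDivisible_segreObj (hM [⟨n, a⟩]).1 (hN [⟨n, b⟩]).1,
      (isShortExact_segreTorsion M N a b).isFlasque_right (ih hM' hN')
        (isFlasque_prod (ih hM' hN) (ih hM hN'))⟩

end GrMod

end Segre

/-! ### Segre products of standard graded algebras are Noetherian -/

namespace IsStandardGraded

variable {k R : Type u} [Field k] [CommRing R] [Algebra k R] {𝒜 : ℕ → Submodule k R}

theorem isNoetherianRing (h : IsStandardGraded 𝒜) : IsNoetherianRing R := by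
  obtain ⟨n, φ, hφ, -⟩ := h
  exact isNoetherianRing_of_surjective _ _ (φ : MvPolynomial (Fin n) k →+* R) hφ

/-- Each graded piece is the image of all polynomials of its degree. -/
theorem exists_eq_map [GradedAlgebra 𝒜] (h : IsStandardGraded 𝒜) :
    ∃ (n : ℕ) (φ : MvPolynomial (Fin n) k →ₐ[k] R),
      ∀ d, 𝒜 d = (MvPolynomial.homogeneousSubmodule (Fin n) k d).map φ.toLinearMap := by
  obtain ⟨n, φ, hφ, hd⟩ := h
  refine ⟨n, φ, fun d => le_antisymm (fun r hr => ?_) (Submodule.map_le_iff_le_comap.2 (hd d))⟩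
  obtain ⟨p, rfl⟩ := hφ r
  refine ⟨MvPolynomial.homogeneousComponent d p,
    MvPolynomial.homogeneousComponent_isHomogeneous d p, ?_⟩
  have key : ∀ i, (DirectSum.decompose 𝒜 (φ (MvPolynomial.homogeneousComponent i p)) d : R)
      = if i = d then φ (MvPolynomial.homogeneousComponent i p) else 0 := by
    intro i
    have hi := hd i _ (MvPolynomial.homogeneousComponent_isHomogeneous i p)
    split_ifs with hid
    · subst hid
      exact DirectSum.decompose_of_mem_same 𝒜 hi
    · exact DirectSum.decompose_of_mem_ne 𝒜 hi hid
  have hp := DirectSum.decompose_of_mem_same 𝒜 hr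
  change φ (MvPolynomial.homogeneousComponent d p) = φ p
  conv_rhs => rw [← hp]
  conv_rhs => rw [← MvPolynomial.sum_homogeneousComponent p, map_sum, DirectSum.decompose_sum]
  rw [DFinsupp.finsetSum_apply, AddSubmonoidClass.coe_finsetSum,
    Finset.sum_congr rfl fun i _ => key i, Finset.sum_ite_eq']
  split_ifs with hmem
  · rfl
  · rw [MvPolynomial.homogeneousComponent_eq_zero, map_zero]
    simpa using hmem

theorem component_zero_le [GradedAlgebra 𝒜] (h : IsStandardGraded 𝒜) :
    𝒜 0 ≤ Submodule.span k {(1 : R)} := by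
  obtain ⟨n, φ, hφ⟩ := h.exists_eq_map
  rw [hφ 0]
  rintro _ ⟨p, hp, rfl⟩
  rw [SetLike.mem_coe, MvPolynomial.mem_homogeneousSubmodule,
    ← MvPolynomial.totalDegree_zero_iff_isHomogeneous,
    MvPolynomial.totalDegree_eq_zero_iff_eq_C] at hp
  rw [hp]
  refine Submodule.mem_span_singleton.2 ⟨MvPolynomial.coeff 0 p, ?_⟩
  exact (Algebra.algebraMap_eq_smul_one _).symm.trans (φ.commutes _).symm

theorem component_succ [GradedAlgebra 𝒜] (h : IsStandardGraded 𝒜) (d : ℕ) :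
    𝒜 (d + 1) = 𝒜 1 * 𝒜 d := by
  obtain ⟨n, φ, hφ⟩ := h.exists_eq_map
  rw [hφ, hφ 1, hφ d, ← Submodule.map_mul, ← MvPolynomial.homogeneousSubmodule_one_pow _ (d + 1),
    ← MvPolynomial.homogeneousSubmodule_one_pow _ d, pow_succ']

theorem finite_component_one [GradedAlgebra 𝒜] (h : IsStandardGraded 𝒜) :
    Module.Finite k (𝒜 1) := by
  obtain ⟨n, φ, hφ⟩ := h.exists_eq_map
  rw [Module.Finite.iff_fg, hφ]
  exact (MvPolynomial.homogeneousSubmodule_fg (Fin n) k 1).map _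

end IsStandardGraded

section SegreNoetherian

variable {k R S : Type u} [Field k] [CommRing R] [Algebra k R] [CommRing S] [Algebra k S]
  {𝒜 : ℕ → Submodule k R} {ℬ : ℕ → Submodule k S} [GradedAlgebra 𝒜] [GradedAlgebra ℬ]

theorem segreTmul_mul {i j q : ℕ} (hq : q = i + j) (a : 𝒜 i) (a' : 𝒜 j) (b : ℬ i) (b' : ℬ j)
    (c : 𝒜 q) (c' : ℬ q) (hc : (c : R) = a * a') (hc' : (c' : S) = b * b') :
    (segreTmul c c' : SegreRing 𝒜 ℬ) = segreTmul a b * segreTmul a' b' := by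
  subst hq
  obtain rfl : c = ⟨a * a', SetLike.GradedMul.mul_mem a.2 a'.2⟩ := Subtype.ext hc
  obtain rfl : c' = ⟨b * b', SetLike.GradedMul.mul_mem b.2 b'.2⟩ := Subtype.ext hc'
  exact (DirectSum.of_mul_of (A := SegreComp 𝒜 ℬ) (a ⊗ₜ[k] b) (a' ⊗ₜ[k] b')).symm

/-- The bilinear map `(a, b) ↦ a ⊗ b` to the Segre product of rings. -/
def segreTmulₗ (n : ℕ) : 𝒜 n →ₗ[k] ℬ n →ₗ[k] SegreRing 𝒜 ℬ :=
  (TensorProduct.mk k (𝒜 n) (ℬ n)).compr₂ (DirectSum.lof k ℕ (SegreComp 𝒜 ℬ) n)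

/-- As `R` and `S` are generated in degree one, so is `R # S`. -/
theorem adjoin_segreGrading_one (h𝒜 : IsStandardGraded 𝒜) (hℬ : IsStandardGraded ℬ) :
    Algebra.adjoin k (segreGrading 𝒜 ℬ 1 : Set (SegreRing 𝒜 ℬ)) = ⊤ := by
  have key : ∀ (n : ℕ) (a : 𝒜 n) (b : ℬ n), segreTmulₗ n a b ∈
      Algebra.adjoin k (segreGrading 𝒜 ℬ 1 : Set (SegreRing 𝒜 ℬ)) := by
    intro n
    induction n with
    | zero =>
      rintro ⟨a, ha⟩ ⟨b, hb⟩
      obtain ⟨r, rfl⟩ := Submodule.mem_span_singleton.1 (h𝒜.component_zero_le ha)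
      obtain ⟨s, rfl⟩ := Submodule.mem_span_singleton.1 (hℬ.component_zero_le hb)
      change segreTmulₗ 0 (r • (⟨1, SetLike.GradedOne.one_mem⟩ : 𝒜 0))
        (s • (⟨1, SetLike.GradedOne.one_mem⟩ : ℬ 0)) ∈ _
      rw [map_smul, map_smul, LinearMap.smul_apply]
      exact Subalgebra.smul_mem _ (Subalgebra.smul_mem _ (one_mem _) r) s
    | succ n ih =>
      rintro ⟨a, ha⟩ ⟨b, hb⟩
      rw [h𝒜.component_succ] at ha
      rw [hℬ.component_succ] at hb
      refine Submodule.mul_induction_on' (C := fun a ha =>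
        segreTmulₗ (n + 1) (⟨a, (h𝒜.component_succ n).ge ha⟩ : 𝒜 (n + 1))
          (⟨b, (hℬ.component_succ n).ge hb⟩ : ℬ (n + 1)) ∈
            Algebra.adjoin k (segreGrading 𝒜 ℬ 1 : Set (SegreRing 𝒜 ℬ))) ?_ ?_ ha
      · intro a₁ ha₁ a₂ ha₂
        refine Submodule.mul_induction_on' (C := fun b hb =>
          segreTmulₗ (n + 1) (⟨a₁ * a₂, _⟩ : 𝒜 (n + 1))
            (⟨b, (hℬ.component_succ n).ge hb⟩ : ℬ (n + 1)) ∈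
              Algebra.adjoin k (segreGrading 𝒜 ℬ 1 : Set (SegreRing 𝒜 ℬ))) ?_ ?_ hb
        · intro b₁ hb₁ b₂ hb₂
          refine (congrArg (· ∈ Algebra.adjoin k (segreGrading 𝒜 ℬ 1 : Set (SegreRing 𝒜 ℬ)))
            (segreTmul_mul (add_comm n 1) ⟨a₁, ha₁⟩ ⟨a₂, ha₂⟩ ⟨b₁, hb₁⟩ ⟨b₂, hb₂⟩ _ _
              rfl rfl)).mpr ?_
          exact mul_mem (Algebra.subset_adjoin (Subtype.property _)) (ih _ _)
        · intro b hb b' hb' h h'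
          have := add_mem h h'
          rwa [← map_add] at this
      · intro a ha a' ha' h h'
        have := add_mem h h'
        rwa [← LinearMap.add_apply, ← map_add] at this
  refine Algebra.eq_top_iff.2 fun t => ?_
  induction t using DirectSum.induction_on with
  | zero => exact zero_mem _
  | add x y hx hy => exact add_mem hx hy
  | of n x =>
    induction x using TensorProduct.induction_on with
    | zero => rw [map_zero]; exact zero_mem _
    | add x y hx hy => rw [map_add]; exact add_mem hx hy
    | tmul a b => exact key n a b

theorem isNoetherianRing_segreRing (h𝒜 : IsStandardGraded 𝒜) (hℬ : IsStandardGraded ℬ) :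
    IsNoetherianRing (SegreRing 𝒜 ℬ) := by
  have := h𝒜.finite_component_one
  have := hℬ.finite_component_one
  obtain ⟨s, hs⟩ : (segreGrading 𝒜 ℬ 1).FG := by
    rw [segreGrading, LinearMap.range_eq_map]
    exact Module.Finite.fg_top.map _
  have : Algebra.FiniteType k (SegreRing 𝒜 ℬ) := ⟨s, by
    rw [← adjoin_segreGrading_one h𝒜 hℬ, ← hs, Algebra.adjoin_span]⟩
  exact Algebra.FiniteType.isNoetherianRing k _

/-- The ideal `I # J` is generated by finitely many elements `a ⊗ b`. -/
theorem exists_span_eq_segreIdeal [IsNoetherianRing (SegreRing 𝒜 ℬ)] (I : HomogeneousIdeal 𝒜)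
    (J : HomogeneousIdeal ℬ) : ∃ L : List (Σ n, 𝒜 n × ℬ n),
      Ideal.span {t | ∃ x ∈ L, t = (segreTmul x.2.1 x.2.2 : SegreRing 𝒜 ℬ)}
        = (segreIdeal I J).toIdeal := by
  classical
  let g : (Σ n, 𝒜 n × ℬ n) → SegreRing 𝒜 ℬ := fun x => segreTmul x.2.1 x.2.2
  let s : Set (Σ n, 𝒜 n × ℬ n) := {x | (x.2.1 : R) ∈ I ∧ (x.2.2 : S) ∈ J}
  have hs : Ideal.span (g '' s) = (segreIdeal I J).toIdeal := by
    refine le_antisymm (Ideal.span_le.2 ?_) fun t ht => ?_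
    · rintro _ ⟨⟨n, a, b⟩, ⟨ha, hb⟩, rfl⟩
      exact segre_of_mem I J (Submodule.apply_mem_map₂ _ ha hb)
    · have key : ∀ n, segreIdealComp I J n ≤ ((Ideal.span (g '' s)).restrictScalars k).comap
          (DirectSum.lof k ℕ (SegreComp 𝒜 ℬ) n) := fun n =>
        Submodule.map₂_le.2 fun a ha b hb => Ideal.subset_span ⟨⟨n, a, b⟩, ⟨ha, hb⟩, rfl⟩
      rw [← DirectSum.sum_support_of t]
      exact sum_mem fun n _ => key n (ht n)
  obtain ⟨t, hts, ht⟩ := (Submodule.fg_span_iff_fg_span_finset_subset (g '' s)).1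
    (IsNoetherian.noetherian (Ideal.span (g '' s)))
  obtain ⟨u, -, rfl⟩ := Finset.subset_set_image_iff.1 hts
  refine ⟨u.toList, ?_⟩
  rw [← hs]
  refine Eq.trans ?_ ht.symm
  congr 1
  ext x
  simp [g, eq_comm]

end SegreNoetherian

namespace GrMod

/-- The `I`-torsion consists of the elements killed by a power of each of finitely many generators
of `I`. -/
theorem mem_torsion_iff {k R : Type u} [Field k] [CommRing R] [Algebra k R]
    {𝒜 : ℕ → Submodule k R} [GradedAlgebra 𝒜] {I : HomogeneousIdeal 𝒜} {L : List (Σ n, 𝒜 n)}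
    (hL : Ideal.span {t | ∃ x ∈ L, t = (x.2 : R)} = I.toIdeal) {M : GrMod 𝒜} {j : ℤ} {z : M.X j} :
    z ∈ (torsion I M).carrier j ↔ ∀ x ∈ L, z ∈ (M.powTorsion x.2).carrier j := by
  constructor
  · rintro ⟨e, he⟩ x hx
    refine ⟨e, fun l h => he _ l h _ (Ideal.pow_mem_pow ?_ e)⟩
    rw [← hL]
    exact Ideal.subset_span ⟨x, hx, rfl⟩
  · intro h
    let Ann : Ideal R := idealOfComponents
      (fun i => LinearMap.ker ((M.act (i := i) (j := j) rfl).flip z)) (by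
        rintro i i' q a u c hq hc hu
        have hu : M.act rfl u z = 0 := hu
        change M.act rfl c z = 0
        rw [← M.act_act hq hc rfl (by rw [hq]; push_cast; ring) rfl z, hu, map_zero])
    have hle : I.toIdeal ≤ Ann.radical := by
      rw [← hL, Ideal.span_le]
      rintro _ ⟨x, hx, rfl⟩
      obtain ⟨e, he⟩ := h x hx
      exact ⟨e, (coe_mem_idealOfComponents _ _ (u := homPow x.2 e)).2 (he _ rfl)⟩
    have hfg : I.toIdeal.FG := by
      classical
      refine hL ▸ Submodule.fg_span ?_
      refine ((List.finite_toSet L).image (fun x => (x.2 : R))).subset ?_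
      rintro _ ⟨x, hx, rfl⟩
      exact ⟨x, hx, rfl⟩
    obtain ⟨e, he⟩ := Ideal.exists_pow_le_of_le_radical_of_fg hle hfg
    refine ⟨e, fun i l hl a ha => ?_⟩
    subst hl
    exact (coe_mem_idealOfComponents _ _).1 (he ha)

end GrMod

/-! ### Resolutions by flasque modules compute local cohomology -/

namespace GrMod

section Homology

variable {k R : Type u} [Field k] [CommRing R] [Algebra k R]
  {𝒜 : ℕ → Submodule k R} [GradedAlgebra 𝒜]

theorem epi_of_surjective {M N : GrMod 𝒜} (f : M ⟶ N)
    (hf : ∀ n, Function.Surjective (Hom.app f n)) : Epi f where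
  left_cancellation g h w := by
    ext n x
    obtain ⟨x, rfl⟩ := hf n x
    exact congrArg (fun φ => Hom.app φ n x) w

theorem isZero_of_forall_eq_zero {M : GrMod 𝒜} (h : ∀ n (x : M.X n), x = 0) : IsZero M := by
  rw [IsZero.iff_id_eq_zero]
  ext n x
  exact h n x

theorem eq_zero_of_isZero {M : GrMod 𝒜} (h : IsZero M) {n : ℤ} (x : M.X n) : x = 0 :=
  congrArg (fun φ : M ⟶ M => Hom.app φ n x) ((IsZero.iff_id_eq_zero M).1 h)

/-- The homology of a short complex of graded modules, as cycles modulo boundaries. -/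
noncomputable def leftHomologyData (S : ShortComplex (GrMod 𝒜)) : S.LeftHomologyData where
  K := (ker S.g).obj
  H := (range ((kerIsLimit S.g).lift (KernelFork.ofι S.f S.zero))).quo
  i := (ker S.g).ι
  π := (range _).π
  wi := ker_ι_comp S.g
  hi := kerIsLimit S.g
  wπ := comp_range_π _
  hπ := cokerIsColimit _

theorem π_leftHomologyData_eq_zero_iff (S : ShortComplex (GrMod 𝒜)) {n : ℤ}
    (z : (ker S.g).obj.X n) :
    Hom.app (leftHomologyData S).π n z = 0 ↔ ∃ y, Hom.app S.f n y = z.1 := by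
  refine (Submodule.Quotient.mk_eq_zero _).trans ⟨?_, ?_⟩
  · rintro ⟨y, hy⟩
    exact ⟨y, congrArg Subtype.val hy⟩
  · rintro ⟨y, hy⟩
    exact ⟨y, Subtype.ext hy⟩

theorem π_leftHomologyData_surjective (S : ShortComplex (GrMod 𝒜)) (n : ℤ) :
    Function.Surjective (Hom.app (leftHomologyData S).π n) :=
  Submodule.mkQ_surjective _

theorem exact_iff_forall {S : ShortComplex (GrMod 𝒜)} :
    S.Exact ↔ ∀ n z, Hom.app S.g n z = 0 → ∃ y, Hom.app S.f n y = z := by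
  rw [(leftHomologyData S).exact_iff]
  constructor
  · intro h n z hz
    exact (π_leftHomologyData_eq_zero_iff S ⟨z, hz⟩).1 (eq_zero_of_isZero h _)
  · intro h
    refine isZero_of_forall_eq_zero fun n x => ?_
    obtain ⟨z, rfl⟩ := π_leftHomologyData_surjective S n x
    exact (π_leftHomologyData_eq_zero_iff S z).2 (h n z.1 z.2)

theorem shortComplex_quasiIso {S S' : ShortComplex (GrMod 𝒜)} (φ : S ⟶ S')
    (inj : ∀ n z, Hom.app S.g n z = 0 → (∃ y, Hom.app S'.f n y = Hom.app φ.τ₂ n z) →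
      ∃ y, Hom.app S.f n y = z)
    (surj : ∀ n w, Hom.app S'.g n w = 0 →
      ∃ z y, Hom.app S.g n z = 0 ∧ w = Hom.app φ.τ₂ n z + Hom.app S'.f n y) :
    ShortComplex.QuasiIso φ := by
  let γ : ShortComplex.LeftHomologyMapData φ (leftHomologyData S) (leftHomologyData S') := default
  have hi : ∀ n z, (show (ker S'.g).obj.X n from Hom.app γ.φK n z).1 = Hom.app φ.τ₂ n z.1 :=
    fun n z => congrArg (fun f : (ker S.g).obj ⟶ S'.X₂ => Hom.app f n z) γ.commi
  have hπ : ∀ n z, Hom.app γ.φH n (Hom.app (leftHomologyData S).π n z)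
      = Hom.app (leftHomologyData S').π n (Hom.app γ.φK n z) := fun n z =>
    congrArg (fun f : (leftHomologyData S).K ⟶ (leftHomologyData S').H => Hom.app f n z) γ.commπ
  rw [γ.quasiIso_iff]
  have : Mono γ.φH := mono_of_injective _ fun n => by
    rw [injective_iff_map_eq_zero]
    intro x hx
    obtain ⟨z, rfl⟩ := π_leftHomologyData_surjective S n x
    rw [hπ] at hx
    obtain ⟨y, hy⟩ := (π_leftHomologyData_eq_zero_iff S' _).1 hx
    exact (π_leftHomologyData_eq_zero_iff S z).2 (inj n z.1 z.2 ⟨y, hy.trans (hi n z)⟩)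
  have : Epi γ.φH := epi_of_surjective _ fun n x => by
    obtain ⟨w, rfl⟩ := π_leftHomologyData_surjective S' n x
    obtain ⟨z, y, hz, hw⟩ := surj n w.1 w.2
    refine ⟨Hom.app (leftHomologyData S).π n ⟨z, hz⟩, ?_⟩
    refine (hπ n ⟨z, hz⟩).trans (Eq.symm ?_)
    rw [← sub_eq_zero]
    refine (map_sub _ _ _).symm.trans ((π_leftHomologyData_eq_zero_iff S' _).2 ⟨y, ?_⟩)
    exact (sub_eq_of_eq_add' (hw.trans (congrArg (· + _) (hi n ⟨z, hz⟩).symm))).symm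
  exact isIso_of_mono_of_epi _

theorem quasiIsoAt_zero {C D : CochainComplex (GrMod 𝒜) ℕ} (f : C ⟶ D)
    (inj : ∀ j z, Hom.app (C.d 0 1) j z = 0 → Hom.app (f.f 0) j z = 0 → z = 0)
    (surj : ∀ j w, Hom.app (D.d 0 1) j w = 0 →
      ∃ z, Hom.app (C.d 0 1) j z = 0 ∧ Hom.app (f.f 0) j z = w) : QuasiIsoAt f 0 := by
  have h0 : ∀ (C : CochainComplex (GrMod 𝒜) ℕ) (j : ℤ) (y : (C.X 0).X j),
      Hom.app (C.d 0 0) j y = 0 := fun C j y => by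
    rw [C.shape 0 0 (by simp)]
    rfl
  rw [CochainComplex.quasiIsoAt₀_iff]
  refine shortComplex_quasiIso _ (fun j z hz => ?_) (fun j w hw => ?_)
  · rintro ⟨y, hy⟩
    exact ⟨0, (map_zero _).trans (inj j z hz (hy.symm.trans (h0 D j y))).symm⟩
  · obtain ⟨z, hz, rfl⟩ := surj j w hw
    exact ⟨z, 0, hz, ((congrArg (_ + ·) (map_zero _)).trans (add_zero _)).symm⟩

theorem quasiIsoAt_succ {C D : CochainComplex (GrMod 𝒜) ℕ} (f : C ⟶ D) (n : ℕ)
    (inj : ∀ j z, Hom.app (C.d (n + 1) (n + 2)) j z = 0 →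
      (∃ y, Hom.app (D.d n (n + 1)) j y = Hom.app (f.f (n + 1)) j z) →
      ∃ y, Hom.app (C.d n (n + 1)) j y = z)
    (surj : ∀ j w, Hom.app (D.d (n + 1) (n + 2)) j w = 0 →
      ∃ z y, Hom.app (C.d (n + 1) (n + 2)) j z = 0 ∧
        w = Hom.app (f.f (n + 1)) j z + Hom.app (D.d n (n + 1)) j y) :
    QuasiIsoAt f (n + 1) := by
  rw [quasiIsoAt_iff' f n (n + 1) (n + 2) (by simp) (by simp)]
  exact shortComplex_quasiIso _ inj surj

/-- `0 → A → C⁰ → C¹ → ⋯` is exact, in terms of elements. -/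
structure IsResolution {A : GrMod 𝒜} (C : CochainComplex (GrMod 𝒜) ℕ) (η : A ⟶ C.X 0) :
    Prop where
  inj : ∀ j, Function.Injective (Hom.app η j)
  zero : η ≫ C.d 0 1 = 0
  exact_zero : ∀ j z, Hom.app (C.d 0 1) j z = 0 → ∃ a, Hom.app η j a = z
  exact_succ : ∀ n j z, Hom.app (C.d (n + 1) (n + 2)) j z = 0 →
    ∃ y, Hom.app (C.d n (n + 1)) j y = z

theorem isResolution_injectiveResolution {A : GrMod 𝒜} (Q : InjectiveResolution A) :
    IsResolution (A := A) Q.cocomplex (Q.ι.f 0) where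
  inj := by
    have h : Mono (Q.ι.f 0) := inferInstance
    exact @injective_of_mono _ _ _ _ _ _ _ A _ (Q.ι.f 0) h
  zero := Q.ι_f_zero_comp_complex_d
  exact_zero := exact_iff_forall.1 Q.exact₀
  exact_succ n := exact_iff_forall.1 (Q.exact_succ n)

namespace IsResolution

variable {A : GrMod 𝒜} {C : CochainComplex (GrMod 𝒜) ℕ} {η : A ⟶ C.X 0}

theorem quasiIso (hC : IsResolution C η) :
    QuasiIso ((CochainComplex.fromSingle₀Equiv C A).symm ⟨η, hC.zero⟩) where
  quasiIsoAt n := by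
    have hf : ((CochainComplex.fromSingle₀Equiv C A).symm ⟨η, hC.zero⟩).f 0 = η := by
      simp [CochainComplex.fromSingle₀Equiv]
    have hz : ∀ (n : ℕ) (j : ℤ) (z : ((((CochainComplex.single₀ (GrMod 𝒜)).obj A).X (n + 1))).X j),
        z = 0 := fun n j z =>
      eq_zero_of_isZero (HomologicalComplex.isZero_single_obj_X _ _ _ _ (Nat.succ_ne_zero n)) z
    cases n with
    | zero =>
      refine quasiIsoAt_zero _ (fun j z _ h => ?_) (fun j w hw => ?_)
      · rw [hf] at h
        exact hC.inj j (h.trans (map_zero _).symm)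
      · obtain ⟨a, rfl⟩ := hC.exact_zero j w hw
        rw [hf]
        exact ⟨a, hz 0 j _, rfl⟩
    | succ n =>
      refine quasiIsoAt_succ _ n (fun j z _ _ => ⟨0, (map_zero _).trans (hz n j z).symm⟩)
        (fun j w hw => ?_)
      obtain ⟨y, rfl⟩ := hC.exact_succ n j w hw
      exact ⟨0, y, map_zero _, ((congrArg (· + _) (map_zero _)).trans (zero_add _)).symm⟩

/-- The identity of `A` lifts to a morphism from a resolution to an injective resolution. -/
theorem exists_hom (hC : IsResolution C η) (Q : InjectiveResolution A) :
    ∃ f : C ⟶ Q.cocomplex, η ≫ f.f 0 = Q.ι.f 0 := by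
  have hη : Mono η := mono_of_injective η hC.inj
  have h₀ : (ShortComplex.mk η (C.d 0 1) hC.zero).Exact := exact_iff_forall.2 hC.exact_zero
  have h₁ : ∀ n, (ShortComplex.mk (C.d n (n + 1)) (C.d (n + 1) (n + 2))
      (C.d_comp_d _ _ _)).Exact := fun n => exact_iff_forall.2 (hC.exact_succ n)
  let ι : A ⟶ Q.cocomplex.X 0 := Q.ι.f 0
  have hι : ι ≫ Q.cocomplex.d 0 1 = 0 := Q.ι_f_zero_comp_complex_d
  let f₀ : C.X 0 ⟶ Q.cocomplex.X 0 := Injective.factorThru ι η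
  have hf₀ : η ≫ f₀ = ι := Injective.comp_factorThru _ _
  have w₀ : η ≫ f₀ ≫ Q.cocomplex.d 0 1 = 0 := by rw [← Category.assoc, hf₀, hι]
  refine ⟨CochainComplex.mkHom _ _ f₀ (h₀.descToInjective (f₀ ≫ Q.cocomplex.d 0 1) w₀)
    (h₀.comp_descToInjective _ w₀).symm fun n g => ?_, hf₀⟩
  have w : C.d n (n + 1) ≫ g.2.1 ≫ Q.cocomplex.d (n + 1) (n + 2) = 0 := by
    rw [← Category.assoc, ← g.2.2, Category.assoc, Q.cocomplex.d_comp_d, comp_zero]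
  exact ⟨(h₁ n).descToInjective (g.2.1 ≫ Q.cocomplex.d (n + 1) (n + 2)) w,
    ((h₁ n).comp_descToInjective _ w).symm⟩

end IsResolution

theorem comm_apply {C D : CochainComplex (GrMod 𝒜) ℕ} (f : C ⟶ D) (n : ℕ) (j : ℤ)
    (z : (C.X n).X j) :
    Hom.app (f.f (n + 1)) j (Hom.app (C.d n (n + 1)) j z)
      = Hom.app (D.d n (n + 1)) j (Hom.app (f.f n) j z) :=
  (congrArg (fun g : C.X n ⟶ D.X (n + 1) => Hom.app g j z) (f.comm n (n + 1))).symm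

theorem d_d_apply (C : CochainComplex (GrMod 𝒜) ℕ) (n : ℕ) (j : ℤ) (z : (C.X n).X j) :
    Hom.app (C.d (n + 1) (n + 2)) j (Hom.app (C.d n (n + 1)) j z) = 0 :=
  app_eq_zero (C.d_comp_d _ _ _) j z

section Cone

variable {C D : CochainComplex (GrMod 𝒜) ℕ} (f : C ⟶ D)

/-- The terms of the mapping cone of `f : C ⟶ D`, in the numbering that begins with `C⁰`. -/
def coneX (C D : CochainComplex (GrMod 𝒜) ℕ) : ℕ → GrMod 𝒜
  | 0 => C.X 0
  | n + 1 => prod (C.X (n + 1)) (D.X n)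

/-- The differential `(c, e) ↦ (d c, f c - d e)` of the mapping cone of `f : C ⟶ D`. -/
def coneD : ∀ n, coneX C D n ⟶ coneX C D (n + 1)
  | 0 => C.d 0 1 ≫ (bicone _ _).inl + f.f 0 ≫ (bicone _ _).inr
  | n + 1 => (bicone _ _).fst ≫ (C.d (n + 1) (n + 2) ≫ (bicone _ _).inl +
      f.f (n + 1) ≫ (bicone _ _).inr) + -((bicone _ _).snd ≫ D.d n (n + 1) ≫ (bicone _ _).inr)

theorem coneD_zero (j : ℤ) (z : (C.X 0).X j) :
    Hom.app (coneD f 0) j z = (Hom.app (C.d 0 1) j z, Hom.app (f.f 0) j z) :=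
  Prod.ext (add_zero _) (zero_add _)

theorem coneD_succ (n : ℕ) (j : ℤ) (z : (C.X (n + 1)).X j) (w : (D.X n).X j) :
    Hom.app (coneD f (n + 1)) j (z, w)
      = (Hom.app (C.d (n + 1) (n + 2)) j z,
        Hom.app (f.f (n + 1)) j z - Hom.app (D.d n (n + 1)) j w) := by
  refine Prod.ext ?_ ?_
  · change Hom.app (C.d (n + 1) (n + 2)) j z + 0 + -0 = _
    rw [add_zero, neg_zero, add_zero]
  · change 0 + Hom.app (f.f (n + 1)) j z + -(Hom.app (D.d n (n + 1)) j w) = _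
    rw [zero_add, sub_eq_add_neg]

theorem coneD_coneD (n : ℕ) (j : ℤ) (z : (coneX C D n).X j) :
    Hom.app (coneD f (n + 1)) j (Hom.app (coneD f n) j z) = 0 := by
  cases n with
  | zero =>
    refine (congrArg _ (coneD_zero f j z)).trans ((coneD_succ f 0 j _ _).trans (Prod.ext ?_ ?_))
    · exact d_d_apply C 0 j z
    · exact sub_eq_zero.2 (comm_apply f 0 j z)
  | succ n =>
    obtain ⟨z, w⟩ := z
    refine (congrArg _ (coneD_succ f n j z w)).trans
      ((coneD_succ f (n + 1) j _ _).trans (Prod.ext ?_ ?_))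
    · exact d_d_apply C (n + 1) j z
    · change Hom.app (f.f (n + 2)) j (Hom.app (C.d (n + 1) (n + 2)) j z) -
        Hom.app (D.d (n + 1) (n + 2)) j
          (Hom.app (f.f (n + 1)) j z - Hom.app (D.d n (n + 1)) j w) = 0
      rw [map_sub, d_d_apply, sub_zero, comm_apply, sub_self]

variable {f} {A : GrMod 𝒜} {η : A ⟶ C.X 0} {θ : A ⟶ D.X 0}

theorem coneD_zero_injective (hC : IsResolution C η) (hD : IsResolution D θ)
    (hf : η ≫ f.f 0 = θ) (j : ℤ) : Function.Injective (Hom.app (coneD f 0) j) := by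
  rw [injective_iff_map_eq_zero]
  intro z hz
  have hz := (coneD_zero f j z).symm.trans hz
  obtain ⟨a, rfl⟩ := hC.exact_zero j z (congrArg Prod.fst hz)
  have ha : Hom.app θ j a = 0 := hf ▸ congrArg Prod.snd hz
  rw [hD.inj j (ha.trans (map_zero _).symm)]
  exact map_zero _

theorem coneD_exact (hC : IsResolution C η) (hD : IsResolution D θ)
    (hf : η ≫ f.f 0 = θ) (n : ℕ) (j : ℤ) (z : (coneX C D (n + 1)).X j)
    (hz : Hom.app (coneD f (n + 1)) j z = 0) : ∃ y, Hom.app (coneD f n) j y = z := by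
  obtain ⟨z, w⟩ := z
  have hz := (coneD_succ f n j z w).symm.trans hz
  have hzw : Hom.app (f.f (n + 1)) j z - Hom.app (D.d n (n + 1)) j w = 0 := congrArg Prod.snd hz
  obtain ⟨y, rfl⟩ := hC.exact_succ n j z (congrArg Prod.fst hz)
  rw [comm_apply, ← map_sub] at hzw
  cases n with
  | zero =>
    obtain ⟨a, ha⟩ := hD.exact_zero j _ hzw
    refine ⟨y - Hom.app η j a, (coneD_zero f j _).trans (Prod.ext ?_ ?_)⟩
    · change Hom.app (C.d 0 1) j (y - Hom.app η j a) = _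
      rw [map_sub, app_eq_zero hC.zero, sub_zero]
    · change Hom.app (f.f 0) j (y - Hom.app η j a) = _
      rw [map_sub, ← comp_app, hf, ha, sub_sub_cancel]
  | succ n =>
    obtain ⟨v, hv⟩ := hD.exact_succ n j _ hzw
    refine ⟨(y, v), (coneD_succ f n j _ _).trans (Prod.ext rfl ?_)⟩
    change Hom.app (f.f (n + 1)) j y - Hom.app (D.d n (n + 1)) j v = w
    rw [hv, sub_sub_cancel]

end Cone

/-- A morphism between flasque resolutions of `A` induces isomorphisms on the cohomology of the
torsion subcomplexes, because the torsion of its mapping cone, an exact complex of flasque modules,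
is exact. -/
theorem quasiIsoAt_map_Γ {I : HomogeneousIdeal 𝒜} {L : List (Σ n, 𝒜 n)}
    (hL : Ideal.span {t | ∃ x ∈ L, t = (x.2 : R)} = I.toIdeal)
    {C D : CochainComplex (GrMod 𝒜) ℕ} {f : C ⟶ D} {A : GrMod 𝒜} {η : A ⟶ C.X 0}
    {θ : A ⟶ D.X 0} (hC : IsResolution C η) (hD : IsResolution D θ) (hf : η ≫ f.f 0 = θ)
    (hCL : ∀ n, IsFlasque L (C.X n)) (hDL : ∀ n, IsFlasque L (D.X n)) (n : ℕ) :
    QuasiIsoAt (((Γ I).mapHomologicalComplex (ComplexShape.up ℕ)).map f) n := by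
  have prim := exists_torsion_primitive (L := L) (coneX C D) (coneD f)
    (fun n => by
      cases n with
      | zero => exact hCL 0
      | succ n => exact isFlasque_prod (hCL (n + 1)) (hDL n))
    (coneD_zero_injective hC hD hf) (coneD_coneD f) (coneD_exact hC hD hf)
  have mem_prod : ∀ {n : ℕ} {j : ℤ} {z : (C.X (n + 1)).X j} {w : (D.X n).X j},
      z ∈ (torsion I (C.X (n + 1))).carrier j → w ∈ (torsion I (D.X n)).carrier j →
      ∀ x ∈ L, ((z, w) : (C.X (n + 1)).X j × (D.X n).X j) ∈
        ((coneX C D (n + 1)).powTorsion x.2).carrier j := by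
    intro n j z w hz hw x hx
    have h₁ := app_mem_powTorsion (bicone (C.X (n + 1)) (D.X n)).inl
      ((mem_torsion_iff hL).1 hz x hx)
    have h₂ := app_mem_powTorsion (bicone (C.X (n + 1)) (D.X n)).inr
      ((mem_torsion_iff hL).1 hw x hx)
    have h₃ : ((z, w) : (C.X (n + 1)).X j × (D.X n).X j) = (z, 0) + (0, w) :=
      Prod.ext (add_zero _).symm (zero_add _).symm
    rw [h₃]
    exact add_mem h₁ h₂
  have mem_fst : ∀ {n : ℕ} {j : ℤ} {z : (C.X (n + 1)).X j} {w : (D.X n).X j},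
      (∀ x ∈ L, ((z, w) : (C.X (n + 1)).X j × (D.X n).X j) ∈
        ((coneX C D (n + 1)).powTorsion x.2).carrier j) →
      z ∈ (torsion I (C.X (n + 1))).carrier j := fun h =>
    (mem_torsion_iff hL).2 fun x hx =>
      app_mem_powTorsion (bicone (C.X (_ + 1)) (D.X _)).fst (h x hx)
  have mem_snd : ∀ {n : ℕ} {j : ℤ} {z : (C.X (n + 1)).X j} {w : (D.X n).X j},
      (∀ x ∈ L, ((z, w) : (C.X (n + 1)).X j × (D.X n).X j) ∈
        ((coneX C D (n + 1)).powTorsion x.2).carrier j) →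
      w ∈ (torsion I (D.X n)).carrier j := fun h =>
    (mem_torsion_iff hL).2 fun x hx =>
      app_mem_powTorsion (bicone (C.X (_ + 1)) (D.X _)).snd (h x hx)
  cases n with
  | zero =>
    refine quasiIsoAt_zero _ (fun j z hz hfz => Subtype.ext ?_) (fun j w hw => ?_)
    · refine coneD_zero_injective hC hD hf j (((coneD_zero f j z.1).trans ?_).trans
        (map_zero _).symm)
      exact Prod.ext (congrArg Subtype.val hz) (congrArg Subtype.val hfz)
    · obtain ⟨y, hy, hyw⟩ := prim 0 (z := (0, w.1)) (by
          refine (coneD_succ f 0 j 0 w.1).trans (Prod.ext (map_zero _) ?_)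
          exact (congrArg₂ (· - ·) (map_zero _) (congrArg Subtype.val hw)).trans (sub_zero 0))
        (mem_prod (zero_mem _) w.2)
      have hyw := (coneD_zero f j y).symm.trans hyw
      exact ⟨⟨y, (mem_torsion_iff hL).2 hy⟩, Subtype.ext (congrArg Prod.fst hyw),
        Subtype.ext (congrArg Prod.snd hyw)⟩
  | succ n =>
    refine quasiIsoAt_succ _ n (fun j z hz => ?_) (fun j w hw => ?_)
    · rintro ⟨w, hw⟩
      obtain ⟨y, hy, hyz⟩ := prim n (z := (z.1, w.1)) (by
          refine (coneD_succ f n j z.1 w.1).trans (Prod.ext (congrArg Subtype.val hz) ?_)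
          exact sub_eq_zero.2 (congrArg Subtype.val hw).symm)
        (mem_prod z.2 w.2)
      cases n with
      | zero =>
        exact ⟨⟨y, (mem_torsion_iff hL).2 hy⟩,
          Subtype.ext (congrArg Prod.fst ((coneD_zero f j y).symm.trans hyz))⟩
      | succ n =>
        obtain ⟨y, v⟩ := y
        exact ⟨⟨y, mem_fst hy⟩,
          Subtype.ext (congrArg Prod.fst ((coneD_succ f n j y v).symm.trans hyz))⟩
    · obtain ⟨y, hy, hyw⟩ := prim (n + 1) (z := (0, w.1)) (by
          refine (coneD_succ f (n + 1) j 0 w.1).trans (Prod.ext (map_zero _) ?_)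
          exact (congrArg₂ (· - ·) (map_zero _) (congrArg Subtype.val hw)).trans (sub_zero 0))
        (mem_prod (zero_mem _) w.2)
      obtain ⟨y, v⟩ := y
      have hyw := (coneD_succ f n j y v).symm.trans hyw
      refine ⟨⟨y, mem_fst hy⟩, -⟨v, mem_snd hy⟩, Subtype.ext (congrArg Prod.fst hyw),
        Subtype.ext ?_⟩
      refine (congrArg Prod.snd hyw).symm.trans ((sub_eq_add_neg _ _).trans ?_)
      exact congrArg (_ + ·) (map_neg (Hom.app (D.d n (n + 1)) j) v).symm

/-- Flasque resolutions compute local cohomology. -/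
theorem nonempty_homology_iso_localCohomology [IsNoetherianRing R] {I : HomogeneousIdeal 𝒜}
    {L : List (Σ n, 𝒜 n)} (hL : Ideal.span {t | ∃ x ∈ L, t = (x.2 : R)} = I.toIdeal)
    {C : CochainComplex (GrMod 𝒜) ℕ} {A : GrMod 𝒜} {η : A ⟶ C.X 0} (hC : IsResolution C η)
    (hCL : ∀ n, IsFlasque L (C.X n)) (n : ℕ) :
    Nonempty ((((Γ I).mapHomologicalComplex (ComplexShape.up ℕ)).obj C).homology n ≅
      (localCohomology I n).obj A) := by
  let Q := injectiveResolution A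
  obtain ⟨f, hf⟩ := hC.exists_hom Q
  have := quasiIsoAt_map_Γ hL hC (isResolution_injectiveResolution Q) hf hCL
    (fun n => (isBaer_of_injective (Q.cocomplex.X n)).isFlasque L) n
  exact ⟨isoOfQuasiIsoAt (((Γ I).mapHomologicalComplex (ComplexShape.up ℕ)).map f) n ≪≫
    (Q.isoRightDerivedObj (Γ I) n).symm⟩

/-- Flasque modules have no higher local cohomology. -/
theorem isZero_localCohomology [IsNoetherianRing R] {I : HomogeneousIdeal 𝒜}
    {L : List (Σ n, 𝒜 n)} (hL : Ideal.span {t | ∃ x ∈ L, t = (x.2 : R)} = I.toIdeal)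
    {A : GrMod 𝒜} (hA : IsFlasque L A) {n : ℕ} (hn : n ≠ 0) :
    IsZero ((localCohomology I n).obj A) := by
  let C := (CochainComplex.single₀ (GrMod 𝒜)).obj A
  have hz : ∀ (n : ℕ) (j : ℤ) (z : (C.X (n + 1)).X j), z = 0 := fun n j z =>
    eq_zero_of_isZero (HomologicalComplex.isZero_single_obj_X _ _ _ _ (Nat.succ_ne_zero n)) z
  have hC : IsResolution (A := A) C (𝟙 A) :=
    { inj := fun j => Function.injective_id
      zero := by
        ext j z
        exact hz 0 j _
      exact_zero := fun j z _ => ⟨z, rfl⟩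
      exact_succ := fun n j z _ => ⟨0, (map_zero _).trans (hz n j z).symm⟩ }
  have hCL : ∀ n, IsFlasque L (C.X n) := fun n => by
    cases n with
    | zero => exact hA
    | succ n =>
      exact isFlasque_of_subsingleton (fun j => ⟨fun a b => (hz n j a).trans (hz n j b).symm⟩) L
  obtain ⟨e⟩ := nonempty_homology_iso_localCohomology hL hC hCL n
  refine IsZero.of_iso ?_ e.symm
  refine ShortComplex.exact_iff_isZero_homology _ |>.1 (exact_iff_forall.2 fun j z _ =>
    ⟨0, (map_zero _).trans (Subtype.ext ?_)⟩)
  obtain ⟨m, rfl⟩ := Nat.exists_eq_succ_of_ne_zero hn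
  exact (hz m j z.1).symm

end Homology

end GrMod

/-! ### The Segre product of two resolutions is a resolution -/

namespace GrMod

section Kunneth

variable {k R S : Type u} [Field k] [CommRing R] [Algebra k R] [CommRing S] [Algebra k S]
  {𝒜 : ℕ → Submodule k R} {ℬ : ℕ → Submodule k S} [GradedAlgebra 𝒜] [GradedAlgebra ℬ]

theorem sum_app {M N : GrMod 𝒜} {ι : Type*} (s : Finset ι) (f : ι → (M ⟶ N)) (n : ℤ) (z : M.X n) :
    Hom.app (∑ a ∈ s, f a : M ⟶ N) n z = ∑ a ∈ s, Hom.app (f a) n z := by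
  classical
  induction s using Finset.induction_on with
  | empty => rfl
  | insert a s ha ih => rw [Finset.sum_insert ha, Finset.sum_insert ha, add_app, ih]

theorem segreMap_injective {M M' : GrMod 𝒜} {N N' : GrMod ℬ} {f : M ⟶ M'} {g : N ⟶ N'}
    (hf : ∀ n, Function.Injective (Hom.app f n)) (hg : ∀ n, Function.Injective (Hom.app g n))
    (n : ℤ) : Function.Injective (Hom.app (segreMap f g) n) :=
  TensorProduct.map_injective_of_flat_flat _ _ (hf n) (hg n)

theorem segreMap_id_left_exact (M : GrMod 𝒜) {N N' N'' : GrMod ℬ} {f : N ⟶ N'} {g : N' ⟶ N''}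
    (w : f ≫ g = 0) (h : ∀ n z, Hom.app g n z = 0 → ∃ y, Hom.app f n y = z) (n : ℤ)
    (z : (segreObj M N').X n) (hz : Hom.app (segreMap (𝟙 M) g) n z = 0) :
    ∃ y, Hom.app (segreMap (𝟙 M) f) n y = z := by
  have hfg : Function.Exact (Hom.app f n) (Hom.app g n) := fun z =>
    ⟨h n z, by rintro ⟨y, rfl⟩; exact app_eq_zero w n y⟩
  exact (Module.Flat.lTensor_exact (M.X n) hfg z).1 hz

theorem segreMap_id_right_exact {M M' M'' : GrMod 𝒜} (N : GrMod ℬ) {f : M ⟶ M'} {g : M' ⟶ M''}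
    (w : f ≫ g = 0) (h : ∀ n z, Hom.app g n z = 0 → ∃ y, Hom.app f n y = z) (n : ℤ)
    (z : (segreObj M' N).X n) (hz : Hom.app (segreMap g (𝟙 N)) n z = 0) :
    ∃ y, Hom.app (segreMap f (𝟙 N)) n y = z := by
  have hfg : Function.Exact (Hom.app f n) (Hom.app g n) := fun z =>
    ⟨h n z, by rintro ⟨y, rfl⟩; exact app_eq_zero w n y⟩
  exact (Module.Flat.rTensor_exact (N.X n) hfg z).1 hz

theorem segreMap_zero_left {M M' : GrMod 𝒜} {N N' : GrMod ℬ} (g : N ⟶ N') :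
    segreMap (0 : M ⟶ M') g = 0 :=
  Hom.ext (funext fun _ => TensorProduct.map_zero_left _)

theorem segreMap_zero_right {M M' : GrMod 𝒜} {N N' : GrMod ℬ} (f : M ⟶ M') :
    segreMap f (0 : N ⟶ N') = 0 :=
  Hom.ext (funext fun _ => TensorProduct.map_zero_right _)

section Total

variable (E : CochainComplex (GrMod 𝒜) ℕ) (F : CochainComplex (GrMod ℬ) ℕ)

/-- The inclusion of `Eⁱ # Fʲ` in the degree `n` term of `E # F`, or zero if `i + j ≠ n`. -/
noncomputable def segreInc (i j n : ℕ) : segreObj (E.X i) (F.X j) ⟶ (segreComplex E F).X n :=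
  HomologicalComplex.ιMapBifunctorOrZero E F (segre 𝒜 ℬ) (ComplexShape.up ℕ) i j n

/-- The projection of the degree `n` term of `E # F` to `Eⁱ # Fʲ`. -/
noncomputable def segrePrj (i j n : ℕ) : (segreComplex E F).X n ⟶ segreObj (E.X i) (F.X j) :=
  HomologicalComplex.mapBifunctorDesc fun i' j' _ =>
    if h : i' = i ∧ j' = j then eqToHom (by rw [h.1, h.2]; rfl) else 0

theorem segreInc_eq {i j n : ℕ} (h : i + j = n) : segreInc E F i j n =
    HomologicalComplex.ιMapBifunctor E F (segre 𝒜 ℬ) (ComplexShape.up ℕ) i j n h :=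
  HomologicalComplex.ιMapBifunctorOrZero_eq _ _ _ _ _ _ _ h

theorem segreInc_comp_segrePrj {i j n : ℕ} (h : i + j = n) (i' j' : ℕ) :
    segreInc E F i j n ≫ segrePrj E F i' j' n =
      if h : i = i' ∧ j = j' then eqToHom (by rw [h.1, h.2]) else 0 := by
  rw [segreInc_eq E F h]
  exact HomologicalComplex.ι_mapBifunctorDesc _ i j h

theorem segrePrj_segreInc_self {i j n : ℕ} (h : i + j = n) (d : ℤ)
    (z : (segreObj (E.X i) (F.X j)).X d) :
    Hom.app (segrePrj E F i j n) d (Hom.app (segreInc E F i j n) d z) = z := by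
  have := segreInc_comp_segrePrj E F h i j
  rw [dif_pos ⟨rfl, rfl⟩, eqToHom_refl] at this
  exact congrArg (fun f : segreObj (E.X i) (F.X j) ⟶ _ => Hom.app f d z) this

theorem segrePrj_segreInc_of_ne {i j n i' j' : ℕ} (h : i + j = n) (hne : i ≠ i') (d : ℤ)
    (z : (segreObj (E.X i) (F.X j)).X d) :
    Hom.app (segrePrj E F i' j' n) d (Hom.app (segreInc E F i j n) d z) = 0 := by
  have := segreInc_comp_segrePrj E F h i' j'
  rw [dif_neg fun h => hne h.1] at this
  exact app_eq_zero this d z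

theorem sum_segrePrj_comp_segreInc (n : ℕ) :
    ∑ s ∈ Finset.HasAntidiagonal.antidiagonal n,
      segrePrj E F s.1 s.2 n ≫ segreInc E F s.1 s.2 n = 𝟙 _ := by
  refine HomologicalComplex.mapBifunctor.hom_ext fun i j (h : i + j = n) => ?_
  rw [← segreInc_eq E F h]
  have hself : segreInc E F i j n ≫ segrePrj E F i j n ≫ segreInc E F i j n =
      segreInc E F i j n := by
    rw [← Category.assoc, segreInc_comp_segrePrj E F h, dif_pos ⟨rfl, rfl⟩, eqToHom_refl,
      Category.id_comp]
  have hne : ∀ i' j', ¬(i = i' ∧ j = j') →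
      segreInc E F i j n ≫ segrePrj E F i' j' n ≫ segreInc E F i' j' n = 0 := by
    intro i' j' hij
    rw [← Category.assoc, segreInc_comp_segrePrj E F h, dif_neg hij, zero_comp]
  refine (Preadditive.comp_sum _ _ _).trans ((Finset.sum_eq_single (i, j) ?_ ?_).trans
    (hself.trans (Category.comp_id _).symm))
  · rintro ⟨i', j'⟩ _ hij
    exact hne i' j' fun e => hij (Prod.ext e.1.symm e.2.symm)
  · exact fun hn => (hn (Finset.HasAntidiagonal.mem_antidiagonal.2 h)).elim

theorem sum_segreInc_segrePrj (n : ℕ) (d : ℤ) (z : ((segreComplex E F).X n).X d) :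
    ∑ s ∈ Finset.HasAntidiagonal.antidiagonal n,
      Hom.app (segreInc E F s.1 s.2 n) d (Hom.app (segrePrj E F s.1 s.2 n) d z) = z :=
  (sum_app _ _ d z).symm.trans
    (congrArg (fun f : (segreComplex E F).X n ⟶ _ => Hom.app f d z)
      (sum_segrePrj_comp_segreInc E F n))

theorem units_smul_app {M N : GrMod 𝒜} (ε : ℤˣ) (f : M ⟶ N) (n : ℤ) (z : M.X n) :
    Hom.app (ε • f) n z = (ε : ℤ) • Hom.app f n z := by
  rcases Int.units_eq_one_or ε with rfl | rfl
  · rw [one_smul, Units.val_one, one_smul]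
  · rw [Units.neg_smul, one_smul, neg_app, Units.val_neg, Units.val_one, neg_smul, one_smul]

theorem segreInc_comp_d {i j n : ℕ} (h : i + j = n) :
    segreInc E F i j n ≫ (segreComplex E F).d n (n + 1) =
      segreMap (E.d i (i + 1)) (𝟙 (F.X j)) ≫ segreInc E F (i + 1) j (n + 1) +
      ((-1 : ℤˣ) ^ i) •
        (segreMap (𝟙 (E.X i)) (F.d j (j + 1)) ≫ segreInc E F i (j + 1) (n + 1)) := by
  have h₁ := HomologicalComplex.mapBifunctor.d₁_eq' E F (segre 𝒜 ℬ) (ComplexShape.up ℕ)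
    (i₁ := i) (i₁' := i + 1) rfl j (n + 1)
  have h₂ := HomologicalComplex.mapBifunctor.d₂_eq' E F (segre 𝒜 ℬ) (ComplexShape.up ℕ)
    i (i₂ := j) (i₂' := j + 1) rfl (n + 1)
  rw [segreInc_eq E F h]
  refine (congrArg (_ ≫ ·) (HomologicalComplex.mapBifunctor.d_eq E F (segre 𝒜 ℬ)
    (ComplexShape.up ℕ) n (n + 1))).trans ((Preadditive.comp_add _ _ _ _ _ _).trans ?_)
  refine congrArg₂ (· + ·) ?_ ?_
  · exact (HomologicalComplex.mapBifunctor.ι_D₁ _ _ _ _ _ _ _ _ _).trans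
      (h₁.trans (one_smul _ _))
  · exact (HomologicalComplex.mapBifunctor.ι_D₂ _ _ _ _ _ _ _ _ _).trans h₂

theorem d_segreInc {i j n : ℕ} (h : i + j = n) (d : ℤ) (z : (segreObj (E.X i) (F.X j)).X d) :
    Hom.app ((segreComplex E F).d n (n + 1)) d (Hom.app (segreInc E F i j n) d z) =
      Hom.app (segreInc E F (i + 1) j (n + 1)) d
        (Hom.app (segreMap (E.d i (i + 1)) (𝟙 (F.X j))) d z) +
      (((-1 : ℤˣ) ^ i : ℤˣ) : ℤ) • Hom.app (segreInc E F i (j + 1) (n + 1)) d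
        (Hom.app (segreMap (𝟙 (E.X i)) (F.d j (j + 1))) d z) := by
  rw [← comp_app, segreInc_comp_d E F h, add_app, units_smul_app, comp_app, comp_app]

theorem eq_zero_of_units_smul {G : Type*} [AddCommGroup G] (ε : ℤˣ) {x : G} (h : (ε : ℤ) • x = 0) :
    x = 0 := by
  rcases Int.units_eq_one_or ε with rfl | rfl <;> simpa using h

variable {E F}

/-- The last coordinate of the differential: if the components of `w` with first index less than `p`
vanish, then the component of `d w` with first index `p` is that of `w`, differentiated in `F`. -/
theorem segreMap_d_segrePrj_eq_zero {p q n : ℕ} (h : p + q = n) {d : ℤ}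
    {w : ((segreComplex E F).X n).X d}
    (hw : ∀ i j, i + j = n → i < p → Hom.app (segrePrj E F i j n) d w = 0)
    (hdw : Hom.app ((segreComplex E F).d n (n + 1)) d w = 0) :
    Hom.app (segreMap (𝟙 (E.X p)) (F.d q (q + 1))) d (Hom.app (segrePrj E F p q n) d w) = 0 := by
  have hsum : ∑ s ∈ Finset.HasAntidiagonal.antidiagonal n,
      Hom.app (segrePrj E F p (q + 1) (n + 1)) d
        (Hom.app ((segreComplex E F).d n (n + 1)) d
          (Hom.app (segreInc E F s.1 s.2 n) d (Hom.app (segrePrj E F s.1 s.2 n) d w))) = 0 := by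
    rw [← map_sum, ← map_sum, sum_segreInc_segrePrj, hdw, map_zero]
  rw [Finset.sum_eq_single (p, q)] at hsum
  · rw [d_segreInc E F h, map_add, map_zsmul,
      segrePrj_segreInc_of_ne E F (by omega) (Nat.succ_ne_self p), zero_add,
      segrePrj_segreInc_self E F (by omega)] at hsum
    exact eq_zero_of_units_smul _ hsum
  · rintro ⟨i, j⟩ hs hne
    have hs : i + j = n := Finset.HasAntidiagonal.mem_antidiagonal.1 hs
    have hip : i ≠ p := by
      rintro rfl
      exact hne (Prod.ext rfl (by dsimp only; omega))
    by_cases hlt : i < p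
    · dsimp only
      rw [hw i j hs hlt, map_zero, map_zero, map_zero]
    · dsimp only
      rw [d_segreInc E F hs, map_add, map_zsmul,
        segrePrj_segreInc_of_ne E F (by omega) (by omega),
        segrePrj_segreInc_of_ne E F (by omega) hip, zero_add, smul_zero]
  · exact fun hn => (hn (Finset.HasAntidiagonal.mem_antidiagonal.2 h)).elim

theorem eq_segreInc_of_segrePrj_eq_zero {n : ℕ} {d : ℤ} {w : ((segreComplex E F).X n).X d}
    (hw : ∀ i j, i + j = n → i < n → Hom.app (segrePrj E F i j n) d w = 0) :
    w = Hom.app (segreInc E F n 0 n) d (Hom.app (segrePrj E F n 0 n) d w) := by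
  conv_lhs => rw [← sum_segreInc_segrePrj E F n d w]
  rw [Finset.sum_eq_single (n, 0)]
  · rintro ⟨i, j⟩ hs hne
    have hs : i + j = n := Finset.HasAntidiagonal.mem_antidiagonal.1 hs
    have hin : i ≠ n := by
      rintro rfl
      exact hne (Prod.ext rfl (by dsimp only; omega))
    dsimp only
    rw [hw i j hs (by omega), map_zero]
  · exact fun hn => (hn (Finset.HasAntidiagonal.mem_antidiagonal.2 (add_zero n))).elim

theorem segreMap_d_eq_zero_of_d_segreInc {n : ℕ} {d : ℤ}
    {x : (segreObj (E.X n) (F.X 0)).X d}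
    (hx : Hom.app ((segreComplex E F).d n (n + 1)) d (Hom.app (segreInc E F n 0 n) d x) = 0) :
    Hom.app (segreMap (E.d n (n + 1)) (𝟙 (F.X 0))) d x = 0 ∧
      Hom.app (segreMap (𝟙 (E.X n)) (F.d 0 1)) d x = 0 := by
  rw [d_segreInc E F (add_zero n)] at hx
  constructor
  · have := congrArg (Hom.app (segrePrj E F (n + 1) 0 (n + 1)) d) hx
    rwa [map_add, map_zsmul, segrePrj_segreInc_self E F rfl,
      segrePrj_segreInc_of_ne E F rfl (Nat.succ_ne_self n).symm, smul_zero, add_zero,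
      map_zero] at this
  · have := congrArg (Hom.app (segrePrj E F n 1 (n + 1)) d) hx
    rw [map_add, map_zsmul, segrePrj_segreInc_of_ne E F (add_zero (n + 1)) (Nat.succ_ne_self n),
      zero_add, zero_add, segrePrj_segreInc_self E F rfl, map_zero] at this
    exact eq_zero_of_units_smul _ this

variable {M : GrMod 𝒜} {N : GrMod ℬ} {η : M ⟶ E.X 0} {θ : N ⟶ F.X 0}

theorem segreMap_swap {M M' : GrMod 𝒜} {N N' : GrMod ℬ} (f : M ⟶ M') (g : N ⟶ N') (d : ℤ)
    (z : (segreObj M N).X d) :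
    Hom.app (segreMap f (𝟙 N')) d (Hom.app (segreMap (𝟙 M) g) d z)
      = Hom.app (segreMap (𝟙 M') g) d (Hom.app (segreMap f (𝟙 N)) d z) := by
  rw [← comp_app, ← comp_app, ← segreMap_comp, ← segreMap_comp]
  simp only [Category.id_comp, Category.comp_id]

theorem segreMap_id_left_comp_eq_zero (M : GrMod 𝒜) {N N' N'' : GrMod ℬ} {f : N ⟶ N'}
    {g : N' ⟶ N''} (w : f ≫ g = 0) (d : ℤ) (z : (segreObj M N).X d) :
    Hom.app (segreMap (𝟙 M) g) d (Hom.app (segreMap (𝟙 M) f) d z) = 0 := by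
  refine app_eq_zero ?_ d z
  rw [← segreMap_comp, w, segreMap_zero_right]

/-- A cocycle of `E # F` concentrated in `Eⁿ # F⁰` comes from a cocycle of `Eⁿ # N`. -/
theorem exists_segreMap_eq (hF : IsResolution F θ) {n : ℕ} {d : ℤ}
    {x : (segreObj (E.X n) (F.X 0)).X d}
    (hx : Hom.app ((segreComplex E F).d n (n + 1)) d (Hom.app (segreInc E F n 0 n) d x) = 0) :
    ∃ a, Hom.app (segreMap (𝟙 (E.X n)) θ) d a = x ∧
      Hom.app (segreMap (E.d n (n + 1)) (𝟙 N)) d a = 0 := by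
  obtain ⟨hE, hF'⟩ := segreMap_d_eq_zero_of_d_segreInc hx
  obtain ⟨a, rfl⟩ := segreMap_id_left_exact (E.X n) hF.zero hF.exact_zero d x hF'
  refine ⟨a, rfl, segreMap_injective (f := 𝟙 (E.X (n + 1))) (fun _ => Function.injective_id)
    hF.inj d ?_⟩
  rw [← segreMap_swap, hE, map_zero]

/-- As the rows `0 → Eⁱ # N → Eⁱ # F⁰ → Eⁱ # F¹ → ⋯` are exact, the components of a cocycle with
first index `0, 1, …` can be removed one after the other by adding coboundaries. -/
theorem exists_segrePrj_sub_d_eq_zero (hF : IsResolution F θ) {n : ℕ} {d : ℤ}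
    {z : ((segreComplex E F).X (n + 1)).X d}
    (hz : Hom.app ((segreComplex E F).d (n + 1) (n + 2)) d z = 0) (p : ℕ) (hp : p ≤ n + 1) :
    ∃ y, ∀ i j, i + j = n + 1 → i < p → Hom.app (segrePrj E F i j (n + 1)) d
      (z - Hom.app ((segreComplex E F).d n (n + 1)) d y) = 0 := by
  induction p with
  | zero => exact ⟨0, fun i j _ h => (Nat.not_lt_zero i h).elim⟩
  | succ p ih =>
    obtain ⟨y, hy⟩ := ih (by omega)
    obtain ⟨q, rfl⟩ : ∃ q, n = p + q := Nat.exists_eq_add_of_le (by omega)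
    have hdw : Hom.app ((segreComplex E F).d (p + q + 1) (p + q + 2)) d
        (z - Hom.app ((segreComplex E F).d (p + q) (p + q + 1)) d y) = 0 := by
      rw [map_sub, hz, d_d_apply, sub_zero]
    obtain ⟨v, hv⟩ := segreMap_id_left_exact (E.X p) (F.d_comp_d _ _ _) (hF.exact_succ q) d _
      (segreMap_d_segrePrj_eq_zero (p := p) (q := q + 1) (by omega) hy hdw)
    set ε : ℤˣ := (-1) ^ p with hε
    refine ⟨y + Hom.app (segreInc E F p q (p + q)) d ((ε : ℤ) • v), fun i j hij hi => ?_⟩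
    rw [map_add, ← sub_sub, map_sub, d_segreInc E F rfl, map_add,
      map_zsmul (Hom.app (segrePrj E F i j (p + q + 1)) d),
      segrePrj_segreInc_of_ne E F (by omega) (by omega), zero_add, ← hε]
    rcases Nat.lt_succ_iff_lt_or_eq.1 hi with hi | rfl
    · rw [hy i j hij hi, segrePrj_segreInc_of_ne E F (by omega) (by omega), smul_zero, sub_zero]
    · obtain rfl : j = q + 1 := by omega
      rw [segrePrj_segreInc_self E F (by omega), map_zsmul, hv, smul_smul, ← Units.val_mul,
        Int.units_mul_self, Units.val_one, one_smul, sub_self]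

/-- If `E` and `F` are resolutions of `M` and `N`, then `E # F` is a resolution of `M # N`. -/
theorem isResolution_segreComplex (hE : IsResolution E η) (hF : IsResolution F θ) :
    IsResolution (segreComplex E F) (segreMap η θ ≫ segreInc E F 0 0 0) where
  inj d := by
    have h : Function.LeftInverse (Hom.app (segrePrj E F 0 0 0) d)
      (Hom.app (segreInc E F 0 0 0) d) := segrePrj_segreInc_self E F rfl d
    exact h.injective.comp (segreMap_injective hE.inj hF.inj d)
  zero := by
    rw [Category.assoc, segreInc_comp_d E F rfl, Preadditive.comp_add, pow_zero, one_smul,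
      ← Category.assoc, ← Category.assoc, ← segreMap_comp, ← segreMap_comp, hE.zero, hF.zero,
      segreMap_zero_left, segreMap_zero_right, zero_comp, zero_comp, add_zero]
  exact_zero d z hz := by
    have hz' := eq_segreInc_of_segrePrj_eq_zero (w := z) (fun _ _ _ h => (Nat.not_lt_zero _ h).elim)
    rw [hz'] at hz
    obtain ⟨a, ha, ha'⟩ := exists_segreMap_eq hF hz
    obtain ⟨m, rfl⟩ := segreMap_id_right_exact N hE.zero hE.exact_zero d a ha'
    refine ⟨m, ?_⟩
    rw [hz', ← ha, comp_app, ← comp_app (segreMap η (𝟙 N)), ← segreMap_comp, Category.comp_id,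
      Category.id_comp]
  exact_succ n d z hz := by
    obtain ⟨y, hy⟩ := exists_segrePrj_sub_d_eq_zero hF hz (n + 1) le_rfl
    have hw := eq_segreInc_of_segrePrj_eq_zero hy
    have hdw : Hom.app ((segreComplex E F).d (n + 1) (n + 2)) d
        (z - Hom.app ((segreComplex E F).d n (n + 1)) d y) = 0 := by
      rw [map_sub, hz, d_d_apply, sub_zero]
    rw [hw] at hdw
    obtain ⟨a, ha, ha'⟩ := exists_segreMap_eq hF hdw
    obtain ⟨b, rfl⟩ := segreMap_id_right_exact N (E.d_comp_d _ _ _) (hE.exact_succ n) d a ha'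
    refine ⟨y + Hom.app (segreInc E F n 0 n) d (Hom.app (segreMap (𝟙 (E.X n)) θ) d b), ?_⟩
    rw [map_add, d_segreInc E F (add_zero n), segreMap_id_left_comp_eq_zero _ hF.zero, map_zero,
      smul_zero, add_zero, segreMap_swap, ha, ← hw, add_sub_cancel]

theorem isFlasque_segreComplex {L : List (Σ n, segreGrading 𝒜 ℬ n)}
    (h : ∀ i j, IsFlasque L (segreObj (E.X i) (F.X j))) (n : ℕ) :
    IsFlasque L ((segreComplex E F).X n) :=
  isFlasque_of_sum_eq_id (Finset.HasAntidiagonal.antidiagonal n) (fun s => segreInc E F s.1 s.2 n)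
    (fun s => segrePrj E F s.1 s.2 n) (sum_segreInc_segrePrj E F n) fun s _ => h s.1 s.2

end Total

end Kunneth

end GrMod

/-! ### Acyclicity of the Segre product of two injective resolutions -/

theorem GrMod.IsResolution.nonempty_homology_zero_iso {k R : Type u} [Field k] [CommRing R]
    [Algebra k R] {𝒜 : ℕ → Submodule k R} [GradedAlgebra 𝒜] {A : GrMod 𝒜}
    {C : CochainComplex (GrMod 𝒜) ℕ} {η : A ⟶ C.X 0} (hC : GrMod.IsResolution C η) :
    Nonempty (C.homology 0 ≅ A) := by
  have := hC.quasiIso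
  exact ⟨(isoOfQuasiIsoAt ((CochainComplex.fromSingle₀Equiv C A).symm ⟨η, hC.zero⟩) 0).symm ≪≫
    HomologicalComplex.singleObjHomologySelfIso (ComplexShape.up ℕ) 0 A⟩

theorem GrMod.IsResolution.isZero_homology {k R : Type u} [Field k] [CommRing R]
    [Algebra k R] {𝒜 : ℕ → Submodule k R} [GradedAlgebra 𝒜] {A : GrMod 𝒜}
    {C : CochainComplex (GrMod 𝒜) ℕ} {η : A ⟶ C.X 0} (hC : GrMod.IsResolution C η) {n : ℕ}
    (hn : n ≠ 0) : IsZero (C.homology n) := by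
  have := hC.quasiIso
  exact (HomologicalComplex.isZero_single_obj_homology (ComplexShape.up ℕ) 0 A n hn).of_iso
    (isoOfQuasiIsoAt ((CochainComplex.fromSingle₀Equiv C A).symm ⟨η, hC.zero⟩) n).symm

theorem mainTheorem9 {k R S : Type u} [Field k] [CommRing R] [Algebra k R] [CommRing S] [Algebra k S]
    (𝒜 : ℕ → Submodule k R) [GradedAlgebra 𝒜] (ℬ : ℕ → Submodule k S) [GradedAlgebra ℬ]
    (h𝒜 : IsStandardGraded 𝒜) (hℬ : IsStandardGraded ℬ)
    (M : GrMod 𝒜) (N : GrMod ℬ) (E : InjectiveResolution M) (F : InjectiveResolution N)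
    (I : HomogeneousIdeal 𝒜) (J : HomogeneousIdeal ℬ) :
    IsAcyclicResolution (GrMod.Γ (segreIdeal I J)) (((GrMod.segre 𝒜 ℬ).obj M).obj N)
        (GrMod.segreComplex E.cocomplex F.cocomplex) ∧
      ∀ n : ℕ, Nonempty
        ((((GrMod.Γ (segreIdeal I J)).mapHomologicalComplex (ComplexShape.up ℕ)).obj
            (GrMod.segreComplex E.cocomplex F.cocomplex)).homology n ≅
          (GrMod.localCohomology (segreIdeal I J) n).obj (((GrMod.segre 𝒜 ℬ).obj M).obj N)) := by
  have := h𝒜.isNoetherianRing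
  have := hℬ.isNoetherianRing
  have := isNoetherianRing_segreRing h𝒜 hℬ
  obtain ⟨L, hL⟩ := exists_span_eq_segreIdeal I J
  have hL' : Ideal.span {t | ∃ x ∈ L.map fun x =>
      (⟨x.1, segreTmul x.2.1 x.2.2⟩ : Σ n, segreGrading 𝒜 ℬ n), t = (x.2 : SegreRing 𝒜 ℬ)} =
      (segreIdeal I J).toIdeal := by
    rw [← hL]
    simp only [List.mem_map, exists_exists_and_eq_and]
  have hflasque := GrMod.isFlasque_segreComplex fun i j => GrMod.isFlasque_segreObj
    (GrMod.isBaer_of_injective (E.cocomplex.X i)).isFlasque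
    (GrMod.isBaer_of_injective (F.cocomplex.X j)).isFlasque L
  have hres := GrMod.isResolution_segreComplex (GrMod.isResolution_injectiveResolution E)
    (GrMod.isResolution_injectiveResolution F)
  exact ⟨⟨hres.nonempty_homology_zero_iso, fun _ hj => hres.isZero_homology hj,
    fun i _ hj => GrMod.isZero_localCohomology hL' (hflasque i) hj⟩,
    GrMod.nonempty_homology_iso_localCohomology hL' hres hflasque⟩
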